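/- Let $M$ be a paracompact Hausdorff smooth manifold of dimension $n$, with its algebra $C^\infty(M)$ of real smooth functions. Let $A$ be a Weil algebra, i.e. a finite-dimensional commutative local real algebra with unit whose maximal ideal $\mathfrak m$ has codimension $1$. Let $M^A$ be its Weil bundle: the manifold of the algebra morphisms $\xi:C^\infty(M)\to A$ for which there is $x\in M$ with $\xi(f)-f(x)\in\mathfrak m$ for all $f$. Let $C^\infty(M^A,A)$ be the $A$-algebra of smooth maps $M^A\to A$; for $f\in C^\infty(M)$ let $f^A\in C^\infty(M^A,A)$ be $f^A(\xi)=\xi(f)$. Vector fields on $M$ are the derivations of $C^\infty(M)$, and differential forms on $M$ are the alternating $C^\infty(M)$-multilinear forms on them. A vector field on $M^A$ is given as a derivation $X:C^\infty(M)\to C^\infty(M^A,A)$, i.e. an $\mathbb R$-linear map with $X(fg)=X(f)g^A+f^AX(g)$; these form a $C^\infty(M^A,A)$-module $\mathfrak X(M^A)$ by $(\varphi X)(f)=\varphi\cdot X(f)$. Such an $X$ acts on every $\varphi\in C^\infty(M^A,A)$ by differentiation: if $\varphi=F(f_1^A,\dots,f_k^A)$ near $\xi$ with $F:A^k\to A$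 smooth, then $X(\varphi)(\xi)=DF(f_1^A(\xi),\dots,f_k^A(\xi))\,(X(f_1)(\xi),\dots,X(f_k)(\xi))$. Differential $A$-forms on $M^A$ are the alternating $C^\infty(M^A,A)$-multilinear forms on $\mathfrak X(M^A)$ with values in $C^\infty(M^A,A)$. Put $(d^A\varphi)(X)=X(\varphi)$ and $(i_X\eta)(Y)=\eta(X,Y)$. The prolongation $\theta^A$ of a vector field $\theta$ on $M$ is $\theta^A(f)=(\theta f)^A$. Let $\Omega$ be a symplectic form on $M$. Then there is exactly one differential $A$-form $\Omega^A$ of degree $2$ on $M^A$ with $\Omega^A(\theta_1^A,\theta_2^A)=(\Omega(\theta_1,\theta_2))^A$ for all vector fields $\theta_1,\theta_2$ on $M$, and for every vector field $\theta$ on $M$: 1. the action of $\theta^A$ is an $A$-linear derivation $\theta^A:C^\infty(M^A,A)\to C^\infty(M^A,A)$, and $\theta^A(g^A)=(\theta g)^A$ for all $g\in C^\infty(M)$; 2. if $f\in C^\infty(M)$ and $i_\theta\Omega=-df$, then $i_{\theta^A}\Omega^A=-d^A(f^A)$; 3. hence, if $\theta$ is globally hamiltonian (there is $f\in C^\infty(M)$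 with $i_\theta\Omega=-df$), then $\theta^A$ is globally hamiltonian on $(M^A,\Omega^A)$ (there is $\varphi\in C^\infty(M^A,A)$ with $i_{\theta^A}\Omega^A=-d^A\varphi$). -/

import Mathlib

open scoped Manifold ContDiff Topology

noncomputable section

namespace WeilBundle

/-- A Weil algebra: a finite dimensional commutative real algebra which is local and whose
maximal ideal has codimension one over `ℝ`. -/
class IsWeilAlgebra (A : Type*) [CommRing A] [Algebra ℝ A] : Prop extends
    IsLocalRing A, Module.Finite ℝ A where
  codim_eq_one : Module.finrank ℝ (A ⧸ IsLocalRing.maximalIdeal A) = 1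

/-! ### Functions, vector fields and forms on the base manifold -/

section Base

variable (n : ℕ) (M : Type*) [TopologicalSpace M] [ChartedSpace (EuclideanSpace ℝ (Fin n)) M]

/-- The algebra `C^∞(M)` of real valued smooth functions on `M`. -/
abbrev Smooth : Type _ := C^∞⟮𝓡 n, M; ℝ⟯

/-- Vector fields on `M`: derivations of the real algebra `C^∞(M)`. -/
abbrev VField : Type _ := Derivation ℝ (Smooth n M) (Smooth n M)

/-- Differential forms of degree `p` on `M`: alternating `C^∞(M)`-multilinear forms on
vector fields. -/
abbrev Form (p : ℕ) : Type _ := (VField n M) [⋀^Fin p]→ₗ[Smooth n M] (Smooth n M)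

variable {n M}

/-- The differential `df`, as a function of vector fields: `(df)(Y) = Y f`. -/
def differential (f : Smooth n M) : VField n M → Smooth n M := fun Y => Y f

/-- The interior product `i_θ Ω`, as a function of vector fields: `(i_θ Ω)(Y) = Ω(θ, Y)`. -/
def interior (Ω : Form n M 2) (θ : VField n M) : VField n M → Smooth n M :=
  fun Y => Ω ![θ, Y]

/-- A 2-form is closed for the de Rham differential. -/
def IsClosedForm (Ω : Form n M 2) : Prop :=
  ∀ X Y Z : VField n M,
    X (Ω ![Y, Z]) - Y (Ω ![X, Z]) + Z (Ω ![X, Y])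
      - Ω ![⁅X, Y⁆, Z] + Ω ![⁅X, Z⁆, Y] - Ω ![⁅Y, Z⁆, X] = 0

/-- A 2-form is nondegenerate at every point `x`: if `Ω_x(X_x, Y_x) = 0` for all `Y`, then the
tangent vector `X_x : f ↦ (X f)(x)` is zero. -/
def IsNondegenerateForm (Ω : Form n M 2) : Prop :=
  ∀ (x : M) (X : VField n M), (∀ Y : VField n M, Ω ![X, Y] x = 0) →
    ∀ f : Smooth n M, X f x = 0

/-- A symplectic form: a closed, nondegenerate 2-form. -/
def IsSymplectic (Ω : Form n M 2) : Prop := IsClosedForm Ω ∧ IsNondegenerateForm Ω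

/-- `θ` is globally hamiltonian: `i_θ Ω = -df` for some `f ∈ C^∞(M)`. -/
def IsGloballyHamiltonian (Ω : Form n M 2) (θ : VField n M) : Prop :=
  ∃ f : Smooth n M, interior Ω θ = -differential f

end Base

/-! ### The Weil bundle -/

section Bundle

variable (n : ℕ) (M : Type*) [TopologicalSpace M] [ChartedSpace (EuclideanSpace ℝ (Fin n)) M]
variable (A : Type*) [NormedCommRing A] [NormedAlgebra ℝ A] [IsWeilAlgebra A]

/-- The set `M^A` of points of `M` near of kind `A`: the morphisms of real algebras
`ξ : C^∞(M) → A` for which there is a point `x` of `M` with `ξ f - f x ∈ 𝔪` for all `f`. -/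
structure NearPoint where
  hom : Smooth n M →ₐ[ℝ] A
  exists_origin : ∃ x : M, ∀ f : Smooth n M,
    hom f - algebraMap ℝ A (f x) ∈ IsLocalRing.maximalIdeal A

/-- The topology of `M^A`: the coarsest one for which all the maps `f^A : ξ ↦ ξ f`,
`f ∈ C^∞(M)`, are continuous. -/
instance : TopologicalSpace (NearPoint n M A) :=
  TopologicalSpace.induced (fun ξ (f : Smooth n M) => ξ.hom f) inferInstance

variable {n M A}

/-- A presentation of `φ : M^A → A` near `ξ` as a smooth function of finitely many
functions `f_i^A`, that is `φ = F(f_1^A, …, f_k^A)` near `ξ` with `F : A^k → A` smooth (over `ℝ`).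
The differentiable structure of `M^A` is the one that the maps `(f_1^A, …, f_k^A)` induce: if
`f_1, …, f_n` restrict to coordinates of `M` near the origin `x` of `ξ`, then
`(f_1^A, …, f_n^A)` is a chart of `M^A` around the fibre over `x`, with values in `A^n`. -/
structure LocalPresentation (φ : NearPoint n M A → A) (ξ : NearPoint n M A) where
  k : ℕ
  f : Fin k → Smooth n M
  F : (Fin k → A) → A
  contDiff : ContDiff ℝ ∞ F
  eventuallyEq : ∀ᶠ ζ in 𝓝 ξ, φ ζ = F (fun i => ζ.hom (f i))

/-- A function `φ : M^A → A` is smooth. -/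
def IsSmooth (φ : NearPoint n M A → A) : Prop := ∀ ξ, Nonempty (LocalPresentation φ ξ)

variable (n M A)

/-- The `A`-algebra `C^∞(M^A, A)` of smooth functions on `M^A` with values in `A`. -/
def smoothSubalgebra : Subalgebra A (NearPoint n M A → A) where
  carrier := {φ | IsSmooth φ}
  mul_mem' := by
    intro φ ψ hφ hψ ξ
    obtain ⟨p⟩ := hφ ξ
    obtain ⟨q⟩ := hψ ξ
    refine ⟨⟨p.k + q.k, Fin.append p.f q.f,
      fun a => p.F (fun i => a (Fin.castAdd _ i)) * q.F (fun i => a (Fin.natAdd _ i)), ?_, ?_⟩⟩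
    · exact (p.contDiff.comp (by fun_prop)).mul (q.contDiff.comp (by fun_prop))
    · filter_upwards [p.eventuallyEq, q.eventuallyEq] with ζ h₁ h₂
      simp [h₁, h₂]
  add_mem' := by
    intro φ ψ hφ hψ ξ
    obtain ⟨p⟩ := hφ ξ
    obtain ⟨q⟩ := hψ ξ
    refine ⟨⟨p.k + q.k, Fin.append p.f q.f,
      fun a => p.F (fun i => a (Fin.castAdd _ i)) + q.F (fun i => a (Fin.natAdd _ i)), ?_, ?_⟩⟩
    · exact (p.contDiff.comp (by fun_prop)).add (q.contDiff.comp (by fun_prop))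
    · filter_upwards [p.eventuallyEq, q.eventuallyEq] with ζ h₁ h₂
      simp [h₁, h₂]
  algebraMap_mem' := by
    intro a ξ
    exact ⟨⟨0, Fin.elim0, fun _ => a, contDiff_const, Filter.Eventually.of_forall fun _ => rfl⟩⟩

/-- The type of smooth functions on `M^A` with values in `A`. -/
abbrev SmoothA : Type _ := smoothSubalgebra n M A

variable {n M}

/-- The morphism of rings `C^∞(M) → C^∞(M^A, A)`, `f ↦ f^A`, with `f^A(ξ) = ξ(f)`. -/
def lift : Smooth n M →+* SmoothA n M A where
  toFun f := ⟨fun ξ => ξ.hom f, fun _ =>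
    ⟨⟨1, fun _ => f, fun a => a 0, by fun_prop, Filter.Eventually.of_forall fun _ => rfl⟩⟩⟩
  map_one' := by ext; simp
  map_mul' _ _ := by ext; simp
  map_zero' := by ext; simp
  map_add' _ _ := by ext; simp

/-- `C^∞(M^A, A)` is a module over `C^∞(M)` through `f ↦ f^A`. -/
instance : Module (Smooth n M) (SmoothA n M A) := Module.compHom _ (lift A)

variable {A} in
lemma smul_eq_lift_mul (f : Smooth n M) (φ : SmoothA n M A) : f • φ = lift A f * φ := rfl

instance : SMulCommClass (SmoothA n M A) (Smooth n M) (SmoothA n M A) where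
  smul_comm φ f ψ := by
    simp only [smul_eq_lift_mul, smul_eq_mul]; ring

variable (n M)

/-- Vector fields on `M^A`: the derivations `X` of `C^∞(M)` into `C^∞(M^A, A)`, that is
`X(f g) = X(f) g^A + f^A X(g)`. At a point `ξ` such an `X` gives the tangent vector
`X_ξ : f ↦ (X f)(ξ)` of `M^A` at `ξ`, the velocity of the curves `γ` in `M^A` through `ξ` along
which every `f^A` has the derivative `(X f)(ξ)`. They form a `C^∞(M^A, A)`-module. -/
abbrev VFieldA : Type _ := Derivation ℝ (Smooth n M) (SmoothA n M A)

/-- Differential `A`-forms of degree `p` on `M^A`: alternating `C^∞(M^A, A)`-multilinear forms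
on the vector fields of `M^A`. -/
abbrev FormA (p : ℕ) : Type _ := (VFieldA n M A) [⋀^Fin p]→ₗ[SmoothA n M A] (SmoothA n M A)

variable {n M A}

/-- The action `X(φ)` of a vector field `X` of `M^A` on `φ ∈ C^∞(M^A, A)`: the derivative of `φ`
along the tangent vectors of `X`. If `φ = F(f_1^A, …, f_k^A)` near `ξ`, then
`X(φ)(ξ) = DF(f_1^A(ξ), …, f_k^A(ξ)) (X(f_1)(ξ), …, X(f_k)(ξ))`; this does not depend on the
presentation. -/
def VFieldA.act (X : VFieldA n M A) (φ : SmoothA n M A) : NearPoint n M A → A := fun ξ =>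
  let p : LocalPresentation (φ : NearPoint n M A → A) ξ := (φ.2 ξ).some
  fderiv ℝ p.F (fun i => ξ.hom (p.f i)) (fun i => (X (p.f i) : NearPoint n M A → A) ξ)

/-- `d^A φ`, as a function of vector fields: `(d^A φ)(Y) = Y(φ)`. -/
def differentialA (φ : SmoothA n M A) : VFieldA n M A → NearPoint n M A → A :=
  fun Y => VFieldA.act Y φ

/-- The interior product `i_X η` of a 2-form on `M^A`, as a function of vector fields:
`(i_X η)(Y) = η(X, Y)`. -/
def interiorA (η : FormA n M A 2) (X : VFieldA n M A) : VFieldA n M A → NearPoint n M A → A :=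
  fun Y => (η ![X, Y] : SmoothA n M A)

/-- `X` is globally hamiltonian for the 2-form `η` on `M^A`: `i_X η = -d^A φ` for some
`φ ∈ C^∞(M^A, A)`. -/
def IsGloballyHamiltonianA (η : FormA n M A 2) (X : VFieldA n M A) : Prop :=
  ∃ φ : SmoothA n M A, interiorA η X = -differentialA φ

variable (A)

/-- The prolongation `θ^A` of a vector field `θ` of `M`: `f ↦ (θ f)^A`. -/
def prolong (θ : VField n M) : VFieldA n M A :=
  Derivation.mk'
    { toFun := fun f => lift A (θ f)
      map_add' := fun f g => by rw [map_add, map_add]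
      map_smul' := fun c f => by
        ext ξ
        rw [Derivation.map_smul]
        exact map_smul ξ.hom c (θ f) }
    (fun f g => by
      change lift A (θ (f * g)) = f • lift A (θ g) + g • lift A (θ f)
      rw [Derivation.leibniz, map_add, smul_eq_mul, smul_eq_mul, map_mul, map_mul]
      rfl)

variable {A}

/-- `αA` is the prolongation `α^A` to `M^A` of the form `α` on `M`:
`α^A(θ_1^A, …, θ_p^A) = (α(θ_1, …, θ_p))^A` for all vector fields `θ_i` of `M`. -/
def IsProlongationForm {p : ℕ} (α : Form n M p) (αA : FormA n M A p) : Prop :=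
  ∀ θ : Fin p → VField n M, αA (fun i => prolong A (θ i)) = lift A (α θ)

end Bundle

end WeilBundle

end

/-!
Everything rests on one fact about the algebra `C^∞(M)`: near a point `q` there are functions
`x_1, …, x_n` and vector fields `∂_1, …, ∂_n`, defined on all of `M`, with `∂_i x_j = δ_{ij}` and
with Hadamard's lemma `f = f(q) + ∑ (x_i - x_i(q)) g_i` (`LocalFrame`, `exists_localFrame`). Let
`ξ : C^∞(M) → A` be a near point with origin `q`. As `ξ(x_i) - x_i(q)` lies in the nilpotent
ideal `𝔪`, repeated use of Hadamard's lemma shows that a derivation `D` along `ξ` is determined by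
the `D(x_i)`, that is `D = ∑ D(x_i) ξ(∂_i ·)` (`LocalFrame.derivation_eq_sum`), and that `ξ` itself
is determined by `q` and the `ξ(x_i)` (`LocalFrame.hom_ext`).

*The action on functions.* The derivative of `F(f_1^A, …, f_k^A)` along a tangent vector is
independent of the presentation because every derivation along `ξ` is the velocity of a curve in
`M^A` (`exists_curve_velocity`). Such curves are written down directly: for `a ∈ 𝔪` and a vector
field `θ`, `f ↦ ∑ a^k / k! · ξ(θ^k f)` is a near point (`expHom`), the sum being finite; starting
from the points of a straight line in the coordinates and applying this for `θ = ∂_1, …, ∂_n`, one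
obtains curves along which the values of the `x_i` have any prescribed derivatives. Linearity and the
Leibniz rule of `φ ↦ θ^A(φ)` then follow from those of the derivative of `F`
(`prolongDerivation`).

*The form.* By the formula for `D`, if `ρ` has its support in the domain of a frame, then
`ρ^A X = ∑ X(x_i) (ρ ∂_i)^A` for every vector field `X` of `M^A`. Where `ρ^A` is invertible it can
be cancelled, so a `C^∞(M^A, A)`-linear form is determined by its values on prolongations
(`eq_of_eq_on_prolong`). Conversely a `C^∞(M)`-linear map `α` from the vector fields of `M` to
`C^∞(M^A, A)` extends by `X ↦ ∑ X(x_i) α(∂_i)`, which does not depend on the frame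
(`extendForm`). Applied in one variable and then in the other, this gives `Ω^A`; it is alternating
by uniqueness. The equation `i_{θ^A} Ω^A = -d^A(f^A)` compares two linear forms, and on
prolongations it is the lift of `i_θ Ω = -df` (`interiorA_prolong`).
-/

open scoped Manifold ContDiff Topology

noncomputable section

namespace WeilBundle

/-! ### Hadamard's lemma -/

universe u

/-- The derivative of an integral over `[0, 1]` in a parameter is again such an integral, with
values in another space, whence an induction over all target spaces. -/
lemma contDiff_nat_integral_param {E : Type u} [NormedAddCommGroup E] [NormedSpace ℝ E]
    [FiniteDimensional ℝ E] (m : ℕ) : ∀ {F : Type u} [NormedAddCommGroup F] [NormedSpace ℝ F]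
    [CompleteSpace F] (H : E × ℝ → F), ContDiff ℝ ∞ H →
      ContDiff ℝ m (fun z => ∫ s in (0 : ℝ)..1, H (z, s)) := by
  induction m with
  | zero =>
    intro F _ _ _ H hH
    rw [Nat.cast_zero, contDiff_zero]
    exact intervalIntegral.continuous_parametric_intervalIntegral_of_continuous'
      (f := fun z s => H (z, s)) (hH.continuous) 0 1
  | succ m ih =>
    intro F _ _ _ H hH
    rw [Nat.cast_succ, contDiff_succ_iff_hasFDerivAt]
    have hH' : ContDiff ℝ ∞ (fun w : E × ℝ =>
        (fderiv ℝ H w).comp (ContinuousLinearMap.inl ℝ E ℝ)) :=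
      (hH.fderiv_right (m := ∞) (by simp)).clm_comp contDiff_const
    have hd : ∀ z s, HasFDerivAt (fun z => H (z, s))
        ((fderiv ℝ H (z, s)).comp (ContinuousLinearMap.inl ℝ E ℝ)) z := fun z s =>
      ((hH.differentiable (by simp) (z, s)).hasFDerivAt).comp z (hasFDerivAt_prodMk_left z s)
    refine ⟨_, ih _ hH', fun z => ?_⟩
    obtain ⟨C, hC⟩ := ((isCompact_closedBall z 1).prod (isCompact_Icc (a := (0 : ℝ)) (b := 1))
      ).exists_bound_of_continuousOn hH'.continuous.continuousOn
    refine (intervalIntegral.hasFDerivAt_integral_of_dominated_of_fderiv_le (𝕜 := ℝ)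
      (bound := fun _ => C) (F := fun z s => H (z, s))
      (F' := fun z s => (fderiv ℝ H (z, s)).comp (ContinuousLinearMap.inl ℝ E ℝ))
      (Metric.closedBall_mem_nhds z one_pos) ?_ ?_ ?_ ?_ ?_ ?_)
    · refine Filter.Eventually.of_forall fun x => Continuous.aestronglyMeasurable ?_
      exact hH.continuous.comp (by fun_prop)
    · refine Continuous.intervalIntegrable ?_ _ _
      exact hH.continuous.comp (by fun_prop)
    · have : SecondCountableTopologyEither ℝ (E →L[ℝ] F) :=
        secondCountableTopologyEither_of_left _ _
      refine Continuous.aestronglyMeasurable ?_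
      exact hH'.continuous.comp (by fun_prop : Continuous fun s : ℝ => (z, s))
    · refine Filter.Eventually.of_forall fun s hs x hx => hC (x, s) ⟨hx, ?_⟩
      rw [Set.uIoc_of_le zero_le_one] at hs
      exact ⟨hs.1.le, hs.2⟩
    · exact intervalIntegrable_const
    · exact Filter.Eventually.of_forall fun s _ x _ => hd x s

lemma contDiff_integral_param {E F : Type u} [NormedAddCommGroup E] [NormedSpace ℝ E]
    [FiniteDimensional ℝ E] [NormedAddCommGroup F] [NormedSpace ℝ F]
    [CompleteSpace F] (H : E × ℝ → F) (hH : ContDiff ℝ ∞ H) :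
    ContDiff ℝ ∞ (fun z => ∫ s in (0 : ℝ)..1, H (z, s)) :=
  contDiff_infty.2 fun m => contDiff_nat_integral_param m H hH

/-- **Hadamard's lemma** on `ℝⁿ`. -/
lemma exists_hadamard {n : ℕ} {h : EuclideanSpace ℝ (Fin n) → ℝ} (hh : ContDiff ℝ ∞ h)
    (q : EuclideanSpace ℝ (Fin n)) :
    ∃ g : Fin n → EuclideanSpace ℝ (Fin n) → ℝ, (∀ i, ContDiff ℝ ∞ (g i)) ∧
      ∀ z, h z = h q + ∑ i, (z i - q i) * g i z := by
  let e : Fin n → EuclideanSpace ℝ (Fin n) := fun i => EuclideanSpace.single i 1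
  have hfd : ContDiff ℝ ∞ (fderiv ℝ h) := hh.fderiv_right (m := ∞) (by simp)
  have hlin : ∀ i, ContDiff ℝ ∞ (fun w : EuclideanSpace ℝ (Fin n) × ℝ =>
      fderiv ℝ h (q + w.2 • (w.1 - q)) (e i)) := fun i =>
    (hfd.comp (by fun_prop)).clm_apply contDiff_const
  refine ⟨fun i z => ∫ s in (0 : ℝ)..1, fderiv ℝ h (q + s • (z - q)) (e i),
    fun i => contDiff_integral_param _ (hlin i), fun z => ?_⟩
  -- `h z - h q` is the integral of the derivative of `h` along the segment from `q` to `z`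
  have hder : ∀ s ∈ Set.uIcc (0 : ℝ) 1, HasDerivAt (fun s : ℝ => h (q + s • (z - q)))
      (fderiv ℝ h (q + s • (z - q)) (z - q)) s := by
    intro s _
    have h1 : HasDerivAt (fun s : ℝ => q + s • (z - q)) (z - q) s := by
      simpa using ((hasDerivAt_id s).smul_const (z - q)).const_add q
    exact ((hh.differentiable (by simp) _).hasFDerivAt).comp_hasDerivAt s h1
  have hcont : ∀ v, Continuous (fun s : ℝ => fderiv ℝ h (q + s • (z - q)) v) := fun v =>
    (hfd.continuous.comp (by fun_prop)).clm_apply continuous_const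
  have hint := intervalIntegral.integral_eq_sub_of_hasDerivAt hder
    ((hcont _).intervalIntegrable _ _)
  have hdec : z - q = ∑ i, (z i - q i) • e i := by
    ext j
    simp [e, Pi.single_apply]
  have hsum : ∀ s : ℝ, fderiv ℝ h (q + s • (z - q)) (z - q) =
      ∑ i, (z i - q i) * fderiv ℝ h (q + s • (z - q)) (e i) := by
    intro s
    generalize q + s • (z - q) = w
    rw [hdec, map_sum]
    simp
  simp only [hsum] at hint
  rw [intervalIntegral.integral_finsetSum fun i _ =>
    ((hcont _).intervalIntegrable _ _).const_mul _] at hint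
  simp only [intervalIntegral.integral_const_mul, one_smul, zero_smul, add_zero,
    add_sub_cancel] at hint
  rw [hint]; ring

/-! ### Local frames -/

section Frame

variable {n : ℕ} {M : Type*} [TopologicalSpace M] [ChartedSpace (EuclideanSpace ℝ (Fin n)) M]

/-- Global functions `x_i` and global vector fields `∂_i` on `M` which restrict to coordinates
and coordinate fields on the open set `U`. Only the consequences needed are recorded: the
duality `∂_i x_j = δ_{ij}`, Hadamard's lemma at the points of `U`, and the existence of
straight curves in the coordinates. -/
structure LocalFrame (n : ℕ) {M : Type*} [TopologicalSpace M]
    [ChartedSpace (EuclideanSpace ℝ (Fin n)) M] (U : Set M) where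
  isOpen : IsOpen U
  coord : Fin n → Smooth n M
  field : Fin n → VField n M
  field_coord : ∀ i j, ∀ y ∈ U, field i (coord j) y = if i = j then 1 else 0
  hadamard : ∀ q ∈ U, ∀ f : Smooth n M, ∃ g : Fin n → Smooth n M,
    ∀ᶠ y in 𝓝 q, f y = f q + ∑ i, (coord i y - coord i q) * g i y
  exists_curve : ∀ q ∈ U, ∀ r : Fin n → ℝ, ∃ c : ℝ → M, c 0 = q ∧ (∀ᶠ t in 𝓝 0, c t ∈ U) ∧
    (∀ᶠ t in 𝓝 0, ∀ j, coord j (c t) = coord j q + t * r j) ∧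
    ∀ f : Smooth n M, DifferentiableAt ℝ (fun t => f (c t)) 0

section Chart

variable {p : M} {χ : SmoothBumpFunction (𝓡 n) p}

lemma mem_source_of_ne_zero {y : M} (hy : χ y ≠ 0) : y ∈ (extChartAt (𝓡 n) p).source := by
  rw [extChartAt_source]
  exact χ.support_subset_source hy

/-- The open set of the points near which the bump function is `1`. -/
def bumpDomain (χ : SmoothBumpFunction (𝓡 n) p) : Set M := {y | ∀ᶠ z in 𝓝 y, χ z = 1}

lemma eq_one_of_mem_bumpDomain {y : M} (hy : y ∈ bumpDomain χ) : χ y = 1 := hy.self_of_nhds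

lemma mem_source_of_mem_bumpDomain {y : M} (hy : y ∈ bumpDomain χ) :
    y ∈ (extChartAt (𝓡 n) p).source :=
  mem_source_of_ne_zero (by rw [eq_one_of_mem_bumpDomain hy]; exact one_ne_zero)

lemma isOpen_bumpDomain : IsOpen (bumpDomain χ) := isOpen_setOfPred_eventually_nhds

variable [IsManifold (𝓡 n) ∞ M]

lemma contDiffOn_comp_extChartAt_symm (p : M) (f : Smooth n M) :
    ContDiffOn ℝ ∞ (f ∘ (extChartAt (𝓡 n) p).symm) (extChartAt (𝓡 n) p).target :=
  (f.contMDiff.comp_contMDiffOn (contMDiffOn_extChartAt_symm p)).contDiffOn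

lemma contDiffOn_fderiv_chart (f : Smooth n M) (v : EuclideanSpace ℝ (Fin n)) :
    ContDiffOn ℝ ∞ (fun z => fderiv ℝ (f ∘ (extChartAt (𝓡 n) p).symm) z v)
      (extChartAt (𝓡 n) p).target :=
  ((contDiffOn_comp_extChartAt_symm p f).fderiv_of_isOpen (m := ∞)
    (isOpen_extChartAt_target p) (by simp)).clm_apply contDiffOn_const

lemma differentiableAt_chart (p : M) (f : Smooth n M) {y : M}
    (hy : y ∈ (extChartAt (𝓡 n) p).source) :
    DifferentiableAt ℝ (f ∘ (extChartAt (𝓡 n) p).symm) (extChartAt (𝓡 n) p y) :=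
  ((contDiffOn_comp_extChartAt_symm p f).contDiffAt
    ((isOpen_extChartAt_target p).mem_nhds ((extChartAt (𝓡 n) p).map_source hy))
    ).differentiableAt (by simp)

end Chart

variable [IsManifold (𝓡 n) ∞ M] [T2Space M]

/-- A smooth function with support in a given neighbourhood of `p` which is `1` at `p`. -/
lemma exists_bump {U : Set M} (hU : IsOpen U) {p : M} (hp : p ∈ U) :
    ∃ ρ : Smooth n M, ρ p = 1 ∧ tsupport ρ ⊆ U := by
  obtain ⟨χ, -, hχ⟩ := (SmoothBumpFunction.nhds_basis_tsupport (I := 𝓡 n) p).mem_iff.1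
    (hU.mem_nhds hp)
  exact ⟨⟨χ, χ.contMDiff⟩, χ.eq_one, hχ⟩

section Chart

variable {p : M} (χ : SmoothBumpFunction (𝓡 n) p)

/-- The function `χ · (g ∘ φ)` on `M`, for the chart `φ` at `p` and a bump function `χ`
at `p`. -/
def bumpExtend (g : EuclideanSpace ℝ (Fin n) → ℝ)
    (hg : ContDiffOn ℝ ∞ g (extChartAt (𝓡 n) p).target) : Smooth n M :=
  ⟨fun y => χ y • g (extChartAt (𝓡 n) p y), χ.contMDiff_smul (by
    exact hg.contMDiffOn.comp contMDiffOn_extChartAt fun y hy =>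
      (extChartAt (𝓡 n) p).map_source (by rwa [extChartAt_source]))⟩

lemma bumpExtend_apply (g : EuclideanSpace ℝ (Fin n) → ℝ)
    (hg : ContDiffOn ℝ ∞ g (extChartAt (𝓡 n) p).target) (y : M) :
    bumpExtend χ g hg y = χ y * g (extChartAt (𝓡 n) p y) := rfl

/-- The derivative `χ · ∂_v f` of `f`, with `∂_v` the constant field `v` in the chart at `p`. -/
def chartDeriv (v : EuclideanSpace ℝ (Fin n)) (f : Smooth n M) : Smooth n M :=
  bumpExtend χ _ (contDiffOn_fderiv_chart f v)

lemma chartDeriv_apply (v : EuclideanSpace ℝ (Fin n)) (f : Smooth n M) (y : M) :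
    chartDeriv χ v f y =
      χ y * fderiv ℝ (f ∘ (extChartAt (𝓡 n) p).symm) (extChartAt (𝓡 n) p y) v := rfl

/-- The vector field `χ · ∂_v` on `M`, with `∂_v` the constant field `v` in the chart at `p`. -/
def chartField (v : EuclideanSpace ℝ (Fin n)) : VField n M :=
  Derivation.mk'
    { toFun := chartDeriv χ v
      map_add' := fun f g => by
        ext y
        change chartDeriv χ v (f + g) y = chartDeriv χ v f y + chartDeriv χ v g y
        simp only [chartDeriv_apply]
        by_cases hy : χ y = 0
        · simp [hy]
        have hs := mem_source_of_ne_zero hy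
        have := fderiv_add (differentiableAt_chart p f hs) (differentiableAt_chart p g hs)
        change χ y * fderiv ℝ (f ∘ _ + g ∘ _) _ v = _
        rw [this, add_apply, mul_add]
      map_smul' := fun c f => by
        ext y
        change chartDeriv χ v (c • f) y = c * chartDeriv χ v f y
        simp only [chartDeriv_apply]
        by_cases hy : χ y = 0
        · simp [hy]
        have := fderiv_const_smul (differentiableAt_chart p f (mem_source_of_ne_zero hy)) c
        change χ y * fderiv ℝ (c • (f ∘ _)) _ v = _
        rw [this, smul_apply, smul_eq_mul, mul_left_comm] }
    (fun f g => by
        ext y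
        change chartDeriv χ v (f * g) y = f y * chartDeriv χ v g y + g y * chartDeriv χ v f y
        simp only [chartDeriv_apply]
        by_cases hy : χ y = 0
        · simp [hy]
        have hs := mem_source_of_ne_zero hy
        have := fderiv_mul (differentiableAt_chart p f hs) (differentiableAt_chart p g hs)
        change χ y * fderiv ℝ ((f ∘ _) * (g ∘ _)) _ v = _
        rw [this]
        simp only [add_apply, smul_apply, smul_eq_mul, Function.comp_apply,
          (extChartAt (𝓡 n) p).left_inv hs]
        ring)

lemma chartField_apply (v : EuclideanSpace ℝ (Fin n)) (f : Smooth n M) (y : M) :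
    chartField χ v f y =
      χ y * fderiv ℝ (f ∘ (extChartAt (𝓡 n) p).symm) (extChartAt (𝓡 n) p y) v := rfl

/-- The coordinate functions of the chart at `p`, cut off by `χ`. -/
def chartCoord (i : Fin n) : Smooth n M :=
  bumpExtend χ (fun z => z i) (by fun_prop)

lemma chartCoord_apply (i : Fin n) (y : M) :
    chartCoord χ i y = χ y * extChartAt (𝓡 n) p y i := rfl

variable {χ}

/-- Near the image of a point of the domain, the coordinates in the chart are the linear ones. -/
lemma chartCoord_symm_eventuallyEq {y : M} (hy : y ∈ bumpDomain χ) (j : Fin n) :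
    (chartCoord χ j) ∘ (extChartAt (𝓡 n) p).symm =ᶠ[𝓝 (extChartAt (𝓡 n) p y)]
      fun z => z j := by
  have hs := mem_source_of_mem_bumpDomain hy
  have ht := (extChartAt (𝓡 n) p).map_source hs
  have hc := continuousAt_extChartAt_symm'' ht
  rw [ContinuousAt, (extChartAt (𝓡 n) p).left_inv hs] at hc
  filter_upwards [hc.eventually hy, (isOpen_extChartAt_target p).mem_nhds ht] with z h1 h2
  rw [Function.comp_apply, chartCoord_apply, h1, (extChartAt (𝓡 n) p).right_inv h2, one_mul]

lemma chartField_coord (i j : Fin n) {y : M} (hy : y ∈ bumpDomain χ) :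
    chartField χ (EuclideanSpace.single i 1) (chartCoord χ j) y = if i = j then 1 else 0 := by
  rw [chartField_apply, (chartCoord_symm_eventuallyEq hy j).fderiv_eq,
    eq_one_of_mem_bumpDomain hy]
  have : HasFDerivAt (fun z : EuclideanSpace ℝ (Fin n) => z j)
      (EuclideanSpace.proj j : EuclideanSpace ℝ (Fin n) →L[ℝ] ℝ) (extChartAt (𝓡 n) p y) :=
    (EuclideanSpace.proj j : EuclideanSpace ℝ (Fin n) →L[ℝ] ℝ).hasFDerivAt
  rw [this.fderiv]
  simp [eq_comm]

lemma chart_hadamard {q : M} (hq : q ∈ bumpDomain χ) (f : Smooth n M) :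
    ∃ g : Fin n → Smooth n M, ∀ᶠ y in 𝓝 q,
      f y = f q + ∑ i, (chartCoord χ i y - chartCoord χ i q) * g i y := by
  have hs := mem_source_of_mem_bumpDomain hq
  have ht := (extChartAt (𝓡 n) p).map_source hs
  set z₀ := extChartAt (𝓡 n) p q with hz₀
  obtain ⟨r, hr, hball⟩ := Metric.nhds_basis_closedBall.mem_iff.1
    ((isOpen_extChartAt_target p).mem_nhds ht)
  -- cut off `f` in the chart, to apply Hadamard's lemma on the whole of `ℝⁿ`
  let ψ : ContDiffBump z₀ := ⟨r / 2, r, by positivity, by linarith⟩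
  have hcd := contDiffOn_comp_extChartAt_symm p f
  have hh : ContDiff ℝ ∞ (fun z => ψ z * (f ∘ (extChartAt (𝓡 n) p).symm) z) := by
    rw [contDiff_iff_contDiffAt]
    intro z
    by_cases hz : z ∈ (extChartAt (𝓡 n) p).target
    · exact ψ.contDiff.contDiffAt.mul
        (hcd.contDiffAt ((isOpen_extChartAt_target p).mem_nhds hz))
    · -- outside the target the bump function vanishes near `z`
      have hz' : z ∈ (Metric.closedBall z₀ r)ᶜ := fun h => hz (hball h)
      refine (contDiffAt_const (c := (0 : ℝ))).congr_of_eventuallyEq ?_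
      filter_upwards [Metric.isClosed_closedBall.isOpen_compl.mem_nhds hz'] with w hw
      have : r ≤ dist w z₀ := (not_le.1 fun h => hw (Metric.mem_closedBall.2 h)).le
      rw [ψ.zero_of_le_dist this, zero_mul]
  obtain ⟨g, hg, hgz⟩ := exists_hadamard hh z₀
  refine ⟨fun i => bumpExtend χ (g i) (hg i).contDiffOn, ?_⟩
  have hcont : Filter.Tendsto (extChartAt (𝓡 n) p) (𝓝 q) (𝓝 z₀) := continuousAt_extChartAt' hs
  filter_upwards [isOpen_bumpDomain.mem_nhds hq, hcont.eventually ψ.eventuallyEq_one]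
    with y hy hψ
  have hys := mem_source_of_mem_bumpDomain hy
  have h1 := hgz (extChartAt (𝓡 n) p y)
  simp only [hψ, Pi.one_apply, one_mul, Function.comp_apply, (extChartAt (𝓡 n) p).left_inv hys,
    ψ.eventuallyEq_one.self_of_nhds] at h1
  rw [h1, hz₀, (extChartAt (𝓡 n) p).left_inv hs]
  simp only [chartCoord_apply, eq_one_of_mem_bumpDomain hy, eq_one_of_mem_bumpDomain hq, one_mul]
  congr 1
  refine Finset.sum_congr rfl fun i _ => ?_
  congr 1
  rw [bumpExtend_apply, eq_one_of_mem_bumpDomain hy, one_mul]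

lemma chart_exists_curve {q : M} (hq : q ∈ bumpDomain χ) (r : Fin n → ℝ) :
    ∃ c : ℝ → M, c 0 = q ∧ (∀ᶠ t in 𝓝 0, c t ∈ bumpDomain χ) ∧
      (∀ᶠ t in 𝓝 0, ∀ j, chartCoord χ j (c t) = chartCoord χ j q + t * r j) ∧
      ∀ f : Smooth n M, DifferentiableAt ℝ (fun t => f (c t)) 0 := by
  have hs := mem_source_of_mem_bumpDomain hq
  have ht := (extChartAt (𝓡 n) p).map_source hs
  let l : ℝ → EuclideanSpace ℝ (Fin n) := fun t => extChartAt (𝓡 n) p q + t • WithLp.toLp 2 r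
  have hl : Differentiable ℝ l := by fun_prop
  have hl0 : l 0 = extChartAt (𝓡 n) p q := by simp [l]
  have hlc : Filter.Tendsto l (𝓝 0) (𝓝 (extChartAt (𝓡 n) p q)) := hl0 ▸ hl.continuous.tendsto 0
  have h0 : (extChartAt (𝓡 n) p).symm (l 0) = q := by
    rw [hl0, (extChartAt (𝓡 n) p).left_inv hs]
  refine ⟨fun t => (extChartAt (𝓡 n) p).symm (l t), h0, ?_, ?_, fun f => ?_⟩
  · have hc := continuousAt_extChartAt_symm'' ht
    rw [ContinuousAt, (extChartAt (𝓡 n) p).left_inv hs] at hc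
    exact (hc.comp hlc).eventually (isOpen_bumpDomain.mem_nhds hq)
  · filter_upwards [hlc.eventually (Filter.eventually_all.2 (chartCoord_symm_eventuallyEq hq))]
      with t h1 j
    refine (h1 j).trans ?_
    rw [chartCoord_apply, eq_one_of_mem_bumpDomain hq]
    simp [l]
  · refine DifferentiableAt.comp (g := f ∘ (extChartAt (𝓡 n) p).symm) (0 : ℝ) ?_
      hl.differentiableAt
    rw [hl0]
    exact differentiableAt_chart p f hs

end Chart

/-- Every point of `M` has a neighbourhood with a frame. -/
lemma exists_localFrame (p : M) : ∃ U : Set M, p ∈ U ∧ Nonempty (LocalFrame n U) := by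
  let χ : SmoothBumpFunction (𝓡 n) p := Classical.arbitrary _
  exact ⟨bumpDomain χ, χ.eventuallyEq_one,
    ⟨{isOpen := isOpen_bumpDomain
      coord := chartCoord χ
      field := fun i => chartField χ (EuclideanSpace.single i 1)
      field_coord := fun i j _ hy => chartField_coord i j hy
      hadamard := fun _ hq f => chart_hadamard hq f
      exists_curve := fun _ hq r => chart_exists_curve hq r }⟩⟩

end Frame

/-! ### Nilpotency of the maximal ideal -/

section Nilpotent

variable (A : Type*) [CommRing A] [Algebra ℝ A] [IsLocalRing A] [Module.Finite ℝ A]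

lemma exists_maximalIdeal_pow_eq_bot :
    ∃ K : ℕ, IsLocalRing.maximalIdeal A ^ K = ⊥ := by
  have : IsArtinianRing A := IsArtinianRing.of_finite ℝ A
  have h := IsArtinianRing.isNilpotent_jacobson_bot (R := A)
  rw [IsLocalRing.jacobson_eq_maximalIdeal ⊥ bot_ne_top] at h
  exact h

/-- An exponent `K` with `𝔪 ^ K = 0`. It is at least `2`, so that a sum over `k < K` always has a
constant and a linear term. -/
def nilExponent : ℕ := (exists_maximalIdeal_pow_eq_bot A).choose + 2

variable {A}

lemma pow_nilExponent_eq_zero {a : A} (ha : a ∈ IsLocalRing.maximalIdeal A) :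
    a ^ nilExponent A = 0 := by
  have h := Ideal.pow_mem_pow ha (exists_maximalIdeal_pow_eq_bot A).choose
  rw [(exists_maximalIdeal_pow_eq_bot A).choose_spec, Ideal.mem_bot] at h
  rw [nilExponent, pow_add, h, zero_mul]

/-- If every value of `S` is a combination of values of `S` with coefficients in `𝔪`, then
`S = 0`, as its values lie in every power of `𝔪`. -/
lemma eq_zero_of_forall_eq_sum {ι T : Type*} [Fintype ι] (S : T → A)
    (h : ∀ f, ∃ (a : ι → A) (g : ι → T), (∀ i, a i ∈ IsLocalRing.maximalIdeal A) ∧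
      S f = ∑ i, a i * S (g i)) (f : T) : S f = 0 := by
  have key : ∀ (k : ℕ) (f : T), S f ∈ IsLocalRing.maximalIdeal A ^ k := by
    intro k
    induction k with
    | zero => intro f; simp
    | succ k ih =>
      intro f
      obtain ⟨a, g, ha, hf⟩ := h f
      rw [hf, pow_succ']
      exact Ideal.sum_mem _ fun i _ => Ideal.mul_mem_mul (ha i) (ih _)
  obtain ⟨K, hK⟩ := exists_maximalIdeal_pow_eq_bot A
  have := key K f
  rwa [hK, Ideal.mem_bot] at this

end Nilpotent

/-! ### Near points and derivations along them -/

section Origin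

variable {n : ℕ} {M : Type*} [TopologicalSpace M] [ChartedSpace (EuclideanSpace ℝ (Fin n)) M]
variable {U : Set M} (F : LocalFrame n U) {q : M}

/-- Evaluation at a point of `M`. -/
def evalHom (q : M) : Smooth n M →ₐ[ℝ] ℝ where
  toFun f := f q
  map_one' := rfl
  map_mul' _ _ := rfl
  map_zero' := rfl
  map_add' _ _ := rfl
  commutes' _ := rfl

@[simp] lemma evalHom_apply (q : M) (f : Smooth n M) : evalHom q f = f q := rfl

/-- Hadamard's lemma in `C^∞(M)`: near `q`, `f` is the element
`f(q) + ∑ (x_i - x_i(q)) g_i`. -/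
lemma LocalFrame.exists_eventually_eq (hq : q ∈ U) (f : Smooth n M) :
    ∃ g : Fin n → Smooth n M, ∀ᶠ y in 𝓝 q, f y = (algebraMap ℝ (Smooth n M) (f q) +
      ∑ i, (F.coord i - algebraMap ℝ (Smooth n M) (F.coord i q)) * g i : Smooth n M) y := by
  obtain ⟨g, hg⟩ := F.hadamard q hq f
  refine ⟨g, hg.mono fun y hy => hy.trans ?_⟩
  rw [← evalHom_apply y (_ + _), map_add, map_sum]
  simp only [map_mul, map_sub, AlgHom.commutes, evalHom_apply, Algebra.algebraMap_self,
    RingHom.id_apply]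

variable {A : Type*} [CommRing A] [Algebra ℝ A] {η : Smooth n M →ₐ[ℝ] A}

/-- `D` is a derivation of `C^∞(M)` into `A`, seen as a module through `η`: a tangent vector
at `η`. -/
def IsDerivationAlong (η : Smooth n M →ₐ[ℝ] A) (D : Smooth n M →ₗ[ℝ] A) : Prop :=
  ∀ f g, D (f * g) = η f * D g + η g * D f

lemma IsDerivationAlong.map_algebraMap {D : Smooth n M →ₗ[ℝ] A} (hD : IsDerivationAlong η D)
    (c : ℝ) : D (algebraMap ℝ _ c) = 0 := by
  have h : D 1 = 0 := by simpa using hD 1 1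
  rw [Algebra.algebraMap_eq_smul_one, map_smul, h, smul_zero]

/-- The point `q` of `M` as a point near to itself: `f ↦ f(q) · 1`. -/
def constHom (A : Type*) [CommRing A] [Algebra ℝ A] (q : M) : Smooth n M →ₐ[ℝ] A :=
  (Algebra.ofId ℝ A).comp (evalHom q)

lemma constHom_apply (q : M) (f : Smooth n M) : constHom A q f = algebraMap ℝ A (f q) := rfl

variable [IsLocalRing A]

/-- The morphism `η : C^∞(M) → A` is infinitely near to the point `q`. -/
def HasOrigin (η : Smooth n M →ₐ[ℝ] A) (q : M) : Prop :=
  ∀ f : Smooth n M, η f - algebraMap ℝ A (f q) ∈ IsLocalRing.maximalIdeal A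

lemma HasOrigin.isUnit (h : HasOrigin η q) {f : Smooth n M} (hf : f q ≠ 0) : IsUnit (η f) := by
  by_contra hu
  have h1 : η f ∈ IsLocalRing.maximalIdeal A := (IsLocalRing.mem_maximalIdeal _).2 hu
  have h2 := Ideal.sub_mem _ h1 (h f)
  rw [sub_sub_cancel] at h2
  exact (IsLocalRing.mem_maximalIdeal _).1 h2 ((IsUnit.mk0 _ hf).map _)

lemma HasOrigin.sub_smul_mem (h : HasOrigin η q) (f : Smooth n M) :
    η (f - algebraMap ℝ _ (f q)) ∈ IsLocalRing.maximalIdeal A := by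
  rw [map_sub, AlgHom.commutes]
  exact h f

lemma hasOrigin_evalHom (q : M) : HasOrigin (evalHom (n := n) q) q := fun f => by simp

lemma hasOrigin_constHom (q : M) : HasOrigin (constHom (n := n) A q) q := fun f => by
  simp [constHom_apply]

/-- The value at `q` of a vector field of `M` is a derivation along the evaluation at `q`. -/
lemma isDerivationAlong_evalHom (θ : VField n M) (q : M) :
    IsDerivationAlong (evalHom q)
      ((evalHom q).toLinearMap ∘ₗ (θ : Smooth n M →ₗ[ℝ] Smooth n M)) := by
  intro f g
  simp

variable [IsManifold (𝓡 n) ∞ M] [T2Space M]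

/-- A function which vanishes near `q` is annihilated by a function which is `1` at `q`. -/
lemma exists_mul_eq_zero {f : Smooth n M} (hf : ∀ᶠ y in 𝓝 q, f y = 0) :
    ∃ ρ : Smooth n M, ρ q = 1 ∧ ρ * f = 0 := by
  obtain ⟨U, hU, hUo, hqU⟩ := eventually_nhds_iff.1 hf
  obtain ⟨ρ, h1, h2⟩ := exists_bump (n := n) hUo hqU
  refine ⟨ρ, h1, ?_⟩
  ext y
  change ρ y * f y = 0
  by_cases hy : y ∈ U
  · rw [hU y hy, mul_zero]
  · rw [image_eq_zero_of_notMem_tsupport fun h => hy (h2 h), zero_mul]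

lemma HasOrigin.map_eq_zero (h : HasOrigin η q) {f : Smooth n M} (hf : ∀ᶠ y in 𝓝 q, f y = 0) :
    η f = 0 := by
  obtain ⟨ρ, h1, h2⟩ := exists_mul_eq_zero hf
  have hu := h.isUnit (f := ρ) (by simp [h1])
  rw [← hu.mul_right_eq_zero, ← map_mul, h2, map_zero]

lemma HasOrigin.map_congr (h : HasOrigin η q) {f g : Smooth n M}
    (hf : ∀ᶠ y in 𝓝 q, f y = g y) : η f = η g := by
  rw [← sub_eq_zero, ← map_sub]
  refine h.map_eq_zero ?_
  filter_upwards [hf] with y hy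
  change f y - g y = 0
  rw [hy, sub_self]

lemma IsDerivationAlong.map_eq_zero {D : Smooth n M →ₗ[ℝ] A} (hD : IsDerivationAlong η D)
    (h : HasOrigin η q) {f : Smooth n M} (hf : ∀ᶠ y in 𝓝 q, f y = 0) : D f = 0 := by
  obtain ⟨ρ, h1, h2⟩ := exists_mul_eq_zero hf
  have hu := h.isUnit (f := ρ) (by simp [h1])
  rw [← hu.mul_right_eq_zero]
  have := hD ρ f
  rwa [h2, map_zero, h.map_eq_zero hf, zero_mul, add_zero, eq_comm] at this

lemma IsDerivationAlong.map_congr {D : Smooth n M →ₗ[ℝ] A} (hD : IsDerivationAlong η D)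
    (h : HasOrigin η q) {f g : Smooth n M} (hf : ∀ᶠ y in 𝓝 q, f y = g y) : D f = D g := by
  rw [← sub_eq_zero, ← map_sub]
  refine hD.map_eq_zero h ?_
  filter_upwards [hf] with y hy
  change f y - g y = 0
  rw [hy, sub_self]

/-- Vector fields of `M` are local operators. -/
lemma VField.eventually_congr (θ : VField n M) {f g : Smooth n M}
    (hf : ∀ᶠ y in 𝓝 q, f y = g y) : ∀ᶠ y in 𝓝 q, θ f y = θ g y := by
  filter_upwards [hf.eventually_nhds] with y hy
  exact (isDerivationAlong_evalHom θ y).map_congr (hasOrigin_evalHom y) hy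

variable [Module.Finite ℝ A]

/-- By Hadamard's lemma and the nilpotency of `𝔪`, a tangent vector at a near point is
determined by its values on the coordinates. -/
lemma LocalFrame.derivation_eq_zero (hq : q ∈ U) (h : HasOrigin η q)
    {D : Smooth n M →ₗ[ℝ] A} (hD : IsDerivationAlong η D) (hx : ∀ i, D (F.coord i) = 0)
    (f : Smooth n M) : D f = 0 := by
  refine eq_zero_of_forall_eq_sum (ι := Fin n) D (fun f => ?_) f
  obtain ⟨g, hg⟩ := F.exists_eventually_eq hq f
  refine ⟨_, g, fun i => h.sub_smul_mem (F.coord i), ?_⟩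
  rw [hD.map_congr h hg, map_add, map_sum, hD.map_algebraMap, zero_add]
  refine Finset.sum_congr rfl fun i _ => ?_
  rw [hD, map_sub D, hx, hD.map_algebraMap, sub_zero, mul_zero, add_zero]

/-- A near point is determined by its origin and its values on the coordinates. -/
lemma LocalFrame.hom_ext (hq : q ∈ U) (h : HasOrigin η q) {η' : Smooth n M →ₐ[ℝ] A}
    (h' : HasOrigin η' q) (hx : ∀ i, η (F.coord i) = η' (F.coord i)) : η = η' := by
  ext f
  rw [← sub_eq_zero]
  refine eq_zero_of_forall_eq_sum (ι := Fin n) (fun f => η f - η' f) (fun f => ?_) f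
  obtain ⟨g, hg⟩ := F.exists_eventually_eq hq f
  refine ⟨_, g, fun i => h.sub_smul_mem (F.coord i), ?_⟩
  rw [h.map_congr hg, h'.map_congr hg]
  simp only [map_add, map_sum, map_mul, map_sub, AlgHom.commutes, hx, mul_sub,
    Finset.sum_sub_distrib]
  ring

/-- In a frame, a tangent vector `D` at a near point is `∑ D(x_i) ∂_i`. -/
lemma LocalFrame.derivation_eq_sum (hq : q ∈ U) (h : HasOrigin η q)
    {D : Smooth n M →ₗ[ℝ] A} (hD : IsDerivationAlong η D) (f : Smooth n M) :
    D f = ∑ i, D (F.coord i) * η (F.field i f) := by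
  let D' : Smooth n M →ₗ[ℝ] A := D - ∑ i, LinearMap.mulLeft ℝ (D (F.coord i)) ∘ₗ
    η.toLinearMap ∘ₗ (F.field i : Smooth n M →ₗ[ℝ] Smooth n M)
  have hD'f : ∀ f, D' f = D f - ∑ i, D (F.coord i) * η (F.field i f) := fun f => by
    simp [D', LinearMap.sum_apply]
  have hD' : IsDerivationAlong η D' := by
    intro f g
    simp only [hD'f, hD f g, Derivation.leibniz, map_add, smul_eq_mul, map_mul, mul_add, mul_sub,
      Finset.sum_add_distrib, Finset.mul_sum]
    have : ∀ u v w : A, u * (v * w) = v * (u * w) := fun u v w => by ring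
    simp only [this (D _)]
    ring
  rw [← sub_eq_zero, ← hD'f]
  refine F.derivation_eq_zero hq h hD' (fun j => ?_) f
  have hδ : ∀ i, η (F.field i (F.coord j)) = if i = j then 1 else 0 := fun i => by
    have : η (F.field i (F.coord j)) = η (algebraMap ℝ (Smooth n M) (if i = j then 1 else 0)) :=
      h.map_congr (by
        filter_upwards [F.isOpen.mem_nhds hq] with y hy
        rw [F.field_coord i j y hy]
        rfl)
    rw [this, AlgHom.commutes]
    split_ifs <;> simp
  simp [hD'f, hδ]

end Origin

/-! ### The exponential of a nilpotent multiple of a vector field -/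

section Exp

open PowerSeries

/-- The value of a polynomial at a nilpotent element depends only on its first coefficients. -/
lemma eval_eq_of_coeff_eq {A : Type*} [CommRing A] {p r : Polynomial A} {a : A} {K : ℕ}
    (ha : a ^ K = 0)
    (h : ∀ k < K, p.coeff k = r.coeff k) : p.eval a = r.eval a := by
  have hd : (Polynomial.X : Polynomial A) ^ K ∣ p - r := Polynomial.X_pow_dvd_iff.2 fun k hk => by
    rw [Polynomial.coeff_sub, h k hk, sub_self]
  obtain ⟨s, hs⟩ := hd
  rw [← sub_eq_zero, ← Polynomial.eval_sub, hs]
  simp [ha]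

variable {n : ℕ} {M : Type*} [TopologicalSpace M] [ChartedSpace (EuclideanSpace ℝ (Fin n)) M]
variable {A : Type*} [CommRing A] [Algebra ℝ A]

/-- The formal flow of `θ` from `η`: the power series `∑ T^k / k! · η(θ^k f)`. -/
def expSeries (η : Smooth n M →ₐ[ℝ] A) (θ : VField n M) (f : Smooth n M) : A⟦X⟧ :=
  PowerSeries.mk fun k => ((k.factorial : ℝ)⁻¹) • η (θ^[k] f)

variable (η : Smooth n M →ₐ[ℝ] A) (θ : VField n M)

lemma expSeries_add (f g : Smooth n M) :
    expSeries η θ (f + g) = expSeries η θ f + expSeries η θ g := by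
  ext k
  simp [expSeries]

lemma derivative_expSeries (f : Smooth n M) :
    d⁄dX A (expSeries η θ f) = expSeries η θ (θ f) := by
  ext k
  have h : (((k + 1).factorial : ℝ)⁻¹) * ((k : ℝ) + 1) = ((k.factorial : ℝ)⁻¹) := by
    rw [Nat.factorial_succ]
    push_cast
    field_simp
  have hc : ((k : A) + 1) = algebraMap ℝ A ((k : ℝ) + 1) := by simp
  rw [coeff_derivative, expSeries, expSeries, coeff_mk, coeff_mk, Function.iterate_succ_apply,
    hc, mul_comm, ← Algebra.smul_def, smul_smul, mul_comm, h]

/-- The Leibniz formula for the iterates of `θ`: both sides have the same derivative. -/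
lemma expSeries_mul (f g : Smooth n M) :
    expSeries η θ (f * g) = expSeries η θ f * expSeries η θ g := by
  ext k
  induction k generalizing f g with
  | zero => simp [expSeries]
  | succ k ih =>
    have hu : IsUnit ((k : A) + 1) := by
      have : ((k : A) + 1) = algebraMap ℝ A ((k : ℝ) + 1) := by simp
      rw [this]
      exact (IsUnit.mk0 _ (by positivity)).map _
    rw [← hu.mul_left_inj, ← coeff_derivative, ← coeff_derivative, derivative_expSeries,
      Derivation.leibniz (d⁄dX A), derivative_expSeries, derivative_expSeries,
      Derivation.leibniz θ, expSeries_add]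
    simp only [smul_eq_mul, map_add, ih]

lemma expSeries_algebraMap (c : ℝ) :
    expSeries η θ (algebraMap ℝ _ c) = PowerSeries.C (algebraMap ℝ A c) := by
  ext k
  rw [expSeries, coeff_mk, coeff_C]
  cases k with
  | zero => simp
  | succ k =>
    rw [Function.iterate_succ_apply, Derivation.map_algebraMap]
    simp [iterate_map_zero]

variable [IsLocalRing A] [Module.Finite ℝ A]

/-- The near point `η ∘ exp(a θ)`, for `a ∈ 𝔪`: `f ↦ ∑ a^k / k! · η(θ^k f)`. -/
def expHom (a : IsLocalRing.maximalIdeal A) : Smooth n M →ₐ[ℝ] A :=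
  AlgHom.ofLinearMap
    { toFun := fun f => (trunc (nilExponent A) (expSeries η θ f)).eval (a : A)
      map_add' := fun f g => by rw [expSeries_add, map_add, Polynomial.eval_add]
      map_smul' := fun c f => by
        rw [RingHom.id_apply, Algebra.smul_def, expSeries_mul, expSeries_algebraMap,
          Algebra.smul_def]
        rw [← Polynomial.eval_C (x := (a : A)) (a := algebraMap ℝ A c), ← Polynomial.eval_mul]
        refine eval_eq_of_coeff_eq (pow_nilExponent_eq_zero a.2) fun k hk => ?_
        simp [coeff_trunc, hk] }
    (by
      have h := expSeries_algebraMap η θ 1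
      rw [map_one, map_one] at h
      change (trunc _ (expSeries η θ 1)).eval (a : A) = 1
      rw [h, ← Polynomial.eval_one (x := (a : A))]
      refine eval_eq_of_coeff_eq (pow_nilExponent_eq_zero a.2) fun k hk => ?_
      simp [coeff_trunc, hk, Polynomial.coeff_one, coeff_one])
    (fun f g => by
      change (trunc _ (expSeries η θ (f * g))).eval (a : A) =
        (trunc _ (expSeries η θ f)).eval (a : A) * (trunc _ (expSeries η θ g)).eval (a : A)
      rw [← Polynomial.eval_mul, expSeries_mul]
      refine eval_eq_of_coeff_eq (pow_nilExponent_eq_zero a.2) fun k hk => ?_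
      rw [coeff_trunc, if_pos hk, coeff_mul_eq_coeff_trunc_mul_trunc _ _ hk,
        ← Polynomial.coe_mul, Polynomial.coeff_coe])

lemma expHom_apply (a : IsLocalRing.maximalIdeal A) (f : Smooth n M) :
    expHom η θ a f = ∑ k ∈ Finset.range (nilExponent A),
      (((k.factorial : ℝ)⁻¹) • η (θ^[k] f)) * (a : A) ^ k := by
  change (trunc _ (expSeries η θ f)).eval (a : A) = _
  rw [Polynomial.eval, eval₂_trunc_eq_sum_range]
  simp [expSeries]

variable {η} {q : M}

lemma hasOrigin_expHom (h : HasOrigin η q) (a : IsLocalRing.maximalIdeal A) :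
    HasOrigin (expHom η θ a) q := by
  intro f
  rw [expHom_apply, nilExponent, Finset.sum_range_succ', add_sub_assoc]
  refine Ideal.add_mem _ (Ideal.sum_mem _ fun k _ => ?_) (by simpa using h f)
  rw [pow_succ, ← mul_assoc]
  exact Ideal.mul_mem_left _ _ a.2

/-- If `θ x = κ` is constant near the origin, then `exp(a θ)` moves `x` by `κ a`. -/
lemma expHom_apply_of_eventually_const [IsManifold (𝓡 n) ∞ M] [T2Space M] (h : HasOrigin η q)
    (a : IsLocalRing.maximalIdeal A) {x : Smooth n M} {κ : ℝ} (hx : ∀ᶠ y in 𝓝 q, θ x y = κ) :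
    expHom η θ a x = η x + κ • (a : A) := by
  have h1 : ∀ᶠ y in 𝓝 q, θ x y = algebraMap ℝ (Smooth n M) κ y := hx
  have h2 : ∀ k, ∀ᶠ y in 𝓝 q, θ^[k + 2] x y = (0 : Smooth n M) y := by
    intro k
    induction k with
    | zero =>
      have := VField.eventually_congr θ h1
      rwa [Derivation.map_algebraMap] at this
    | succ k ih =>
      have := VField.eventually_congr θ ih
      rwa [Derivation.map_zero, ← Function.iterate_succ_apply' (⇑θ)] at this
  rw [expHom_apply, nilExponent, Finset.sum_range_succ', Finset.sum_range_succ']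
  rw [Finset.sum_eq_zero]
  · have h3 : η (θ x) = algebraMap ℝ A κ := by rw [h.map_congr h1, AlgHom.commutes]
    simp [h3, Algebra.smul_def, add_comm]
  · intro k _
    rw [h.map_congr (h2 k)]
    simp

/-- The composite of the exponentials of the `a_i θ_i`, for `i` in a list. -/
def expList (η : Smooth n M →ₐ[ℝ] A) (θ : Fin n → VField n M)
    (a : Fin n → IsLocalRing.maximalIdeal A) : List (Fin n) → (Smooth n M →ₐ[ℝ] A)
  | [] => η
  | i :: l => expHom (expList η θ a l) (θ i) (a i)

lemma hasOrigin_expList (h : HasOrigin η q) (θ : Fin n → VField n M)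
    (a : Fin n → IsLocalRing.maximalIdeal A) (l : List (Fin n)) :
    HasOrigin (expList η θ a l) q := by
  induction l with
  | nil => exact h
  | cons i l ih => exact hasOrigin_expHom _ ih _

lemma expList_coord [IsManifold (𝓡 n) ∞ M] [T2Space M] (h : HasOrigin η q) {U : Set M}
    (F : LocalFrame n U) (hq : q ∈ U) (a : Fin n → IsLocalRing.maximalIdeal A) (j : Fin n) :
    expList η F.field a (List.finRange n) (F.coord j) = η (F.coord j) + a j := by
  have key : ∀ l : List (Fin n), expList η F.field a l (F.coord j) =
      η (F.coord j) + (l.map fun i => (if i = j then (1 : ℝ) else 0) • (a i : A)).sum := by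
    intro l
    induction l with
    | nil => simp [expList]
    | cons i l ih =>
      rw [expList, expHom_apply_of_eventually_const (F.field i)
        (hasOrigin_expList h F.field a l) (a i) (κ := if i = j then 1 else 0), ih, List.map_cons,
        List.sum_cons, add_comm (_ • _), add_assoc]
      filter_upwards [F.isOpen.mem_nhds hq] with y hy
      exact F.field_coord i j y hy
  rw [key, ← Fin.sum_univ_def]
  simp

end Exp

/-! ### Curves in the Weil bundle and the action of vector fields -/

section Curve

variable {n : ℕ} {M : Type*} [TopologicalSpace M] [ChartedSpace (EuclideanSpace ℝ (Fin n)) M]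
variable {A : Type*} [NormedCommRing A] [NormedAlgebra ℝ A] [IsWeilAlgebra A]

lemma NearPoint.ext_hom {ξ ζ : NearPoint n M A} (h : ξ.hom = ζ.hom) : ξ = ζ := by
  cases ξ; cases ζ; cases h; rfl

lemma NearPoint.exists_hasOrigin (ξ : NearPoint n M A) : ∃ q : M, HasOrigin ξ.hom q :=
  ξ.exists_origin

/-- A Weil algebra is `ℝ ⊕ 𝔪`. -/
lemma exists_sub_algebraMap_mem (a : A) :
    ∃ r : ℝ, a - algebraMap ℝ A r ∈ IsLocalRing.maximalIdeal A := by
  have h1 : Module.finrank ℝ (A ⧸ IsLocalRing.maximalIdeal A) = 1 := IsWeilAlgebra.codim_eq_one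
  obtain ⟨r, hr⟩ := (finrank_eq_one_iff_of_nonzero' (1 : A ⧸ IsLocalRing.maximalIdeal A)
    one_ne_zero).1 h1 (Ideal.Quotient.mk _ a)
  refine ⟨r, ?_⟩
  rw [← Ideal.Quotient.eq, ← hr, Algebra.algebraMap_eq_smul_one]
  rfl

lemma differentiableAt_expList {c : ℝ → M}
    (hc : ∀ f : Smooth n M, DifferentiableAt ℝ (fun t => f (c t)) 0)
    (θ : Fin n → VField n M) (a m : Fin n → IsLocalRing.maximalIdeal A) (l : List (Fin n))
    (f : Smooth n M) : DifferentiableAt ℝ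
      (fun t : ℝ => expList (constHom A (c t)) θ (fun i => a i + t • m i) l f) 0 := by
  induction l generalizing f with
  | nil => exact (algebraMapCLM ℝ A).differentiableAt.comp (0 : ℝ) (hc f)
  | cons i l ih =>
    simp only [expList, expHom_apply]
    refine DifferentiableAt.fun_sum fun k _ =>
      ((ih _).fun_const_smul _).fun_mul (DifferentiableAt.fun_pow ?_ _)
    have h : (fun t : ℝ => ((a i + t • m i : IsLocalRing.maximalIdeal A) : A)) =
        fun t : ℝ => (a i : A) + t • (m i : A) := rfl
    rw [h]
    fun_prop

variable [IsManifold (𝓡 n) ∞ M] [T2Space M]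

/-- Every derivation along a near point `ξ` is the velocity of a curve of near points. In
coordinates, `D(x_i) = r_i + m_i` with `r_i` real and `m_i ∈ 𝔪`; the curve moves the origin of
`ξ` along `r` and the nilpotent part of `ξ` along `m`. -/
lemma exists_curve_velocity (ξ : NearPoint n M A) {D : Smooth n M →ₗ[ℝ] A}
    (hD : IsDerivationAlong ξ.hom D) : ∃ γ : ℝ → NearPoint n M A, γ 0 = ξ ∧
      ∀ f, HasDerivAt (fun t => (γ t).hom f) (D f) 0 := by
  obtain ⟨q, hξ⟩ := ξ.exists_hasOrigin
  obtain ⟨U, hq, ⟨F⟩⟩ := exists_localFrame (n := n) q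
  choose r hr using fun i => exists_sub_algebraMap_mem (D (F.coord i))
  obtain ⟨c, hc0, hcU, hcx, hcd⟩ := F.exists_curve q hq r
  let a : Fin n → IsLocalRing.maximalIdeal A := fun i => ⟨_, hξ (F.coord i)⟩
  let m : Fin n → IsLocalRing.maximalIdeal A := fun i => ⟨_, hr i⟩
  have ho : ∀ t, HasOrigin (expList (constHom A (c t)) F.field (fun i => a i + t • m i)
      (List.finRange n)) (c t) := fun t => hasOrigin_expList (hasOrigin_constHom _) _ _ _
  let γ : ℝ → NearPoint n M A := fun t => ⟨_, c t, ho t⟩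
  have hx : ∀ᶠ t in 𝓝 (0 : ℝ), ∀ j, (γ t).hom (F.coord j) =
      ξ.hom (F.coord j) + t • D (F.coord j) := by
    filter_upwards [hcU, hcx] with t h1 h2 j
    refine (expList_coord (hasOrigin_constHom _) F h1 _ j).trans ?_
    rw [constHom_apply, h2]
    simp only [a, m, Submodule.coe_add, Submodule.coe_smul_of_tower, map_add, map_mul, smul_sub,
      ← Algebra.smul_def]
    ring
  have h0 : γ 0 = ξ := by
    refine NearPoint.ext_hom (F.hom_ext (q := q) hq (hc0 ▸ ho 0) hξ fun j => ?_)
    rw [hx.self_of_nhds j, zero_smul, add_zero]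
  have hd : ∀ f, DifferentiableAt ℝ (fun t => (γ t).hom f) 0 :=
    differentiableAt_expList hcd F.field a m _
  -- the velocity of `γ` is a derivation along `ξ`, which agrees with `D` on the coordinates
  let v : Smooth n M →ₗ[ℝ] A :=
    { toFun := fun f => deriv (fun t => (γ t).hom f) 0
      map_add' := fun f g => by
        simp only [map_add]
        exact deriv_fun_add (hd f) (hd g)
      map_smul' := fun s f => by
        simp only [map_smul]
        exact deriv_fun_const_smul s (hd f) }
  have hv : IsDerivationAlong ξ.hom (v - D) := by
    intro f g
    have h1 : v (f * g) = ξ.hom f * v g + ξ.hom g * v f := by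
      have := deriv_fun_mul (hd f) (hd g)
      rw [h0] at this
      simp only [v, LinearMap.coe_mk, AddHom.coe_mk, map_mul]
      rw [this]
      ring
    rw [LinearMap.sub_apply, LinearMap.sub_apply, LinearMap.sub_apply, h1, hD]
    ring
  have hvx : ∀ j, (v - D) (F.coord j) = 0 := by
    intro j
    have h1 : HasDerivAt (fun t : ℝ => ξ.hom (F.coord j) + t • D (F.coord j))
        (D (F.coord j)) 0 := by
      simpa using ((hasDerivAt_id (0 : ℝ)).smul_const (D (F.coord j))).const_add
        (ξ.hom (F.coord j))
    rw [LinearMap.sub_apply, sub_eq_zero]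
    exact (h1.congr_of_eventuallyEq (hx.mono fun t ht => ht j)).deriv
  refine ⟨γ, h0, fun f => ?_⟩
  have := F.derivation_eq_zero hq hξ hv hvx f
  rw [LinearMap.sub_apply, sub_eq_zero] at this
  rw [← this]
  exact (hd f).hasDerivAt

/-- The tangent vector at `ξ` of a vector field of `M^A`. -/
def VFieldA.tangent (X : VFieldA n M A) (ξ : NearPoint n M A) : Smooth n M →ₗ[ℝ] A where
  toFun f := (X f : NearPoint n M A → A) ξ
  map_add' f g := by rw [map_add]; rfl
  map_smul' c f := by rw [Derivation.map_smul]; rfl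

omit [IsManifold (𝓡 n) ∞ M] [T2Space M] in
lemma VFieldA.isDerivationAlong_tangent (X : VFieldA n M A) (ξ : NearPoint n M A) :
    IsDerivationAlong ξ.hom (X.tangent ξ) := by
  intro f g
  change (X (f * g) : NearPoint n M A → A) ξ = _
  rw [Derivation.leibniz]
  rfl

/-- The action of a vector field on a smooth function is computed by any presentation: it is the
derivative along a curve with the given velocity. -/
lemma VFieldA.act_eq (X : VFieldA n M A) (φ : SmoothA n M A) (ξ : NearPoint n M A)
    (p : LocalPresentation (φ : NearPoint n M A → A) ξ) :
    X.act φ ξ = fderiv ℝ p.F (fun i => ξ.hom (p.f i))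
      (fun i => (X (p.f i) : NearPoint n M A → A) ξ) := by
  obtain ⟨γ, h0, hγ⟩ := exists_curve_velocity ξ (X.isDerivationAlong_tangent ξ)
  have hcont : Filter.Tendsto γ (𝓝 0) (𝓝 ξ) := by
    rw [nhds_induced, Filter.tendsto_comap_iff, tendsto_pi_nhds]
    intro f
    have := (hγ f).continuousAt.tendsto
    rwa [h0] at this
  have key : ∀ p : LocalPresentation (φ : NearPoint n M A → A) ξ,
      HasDerivAt (fun t => (φ : NearPoint n M A → A) (γ t))
        (fderiv ℝ p.F (fun i => ξ.hom (p.f i))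
          (fun i => (X (p.f i) : NearPoint n M A → A) ξ)) 0 := by
    intro p
    have h1 : HasDerivAt (fun t i => (γ t).hom (p.f i))
        (fun i => (X (p.f i) : NearPoint n M A → A) ξ) 0 :=
      hasDerivAt_pi.2 fun i => hγ (p.f i)
    have h2 : HasFDerivAt p.F (fderiv ℝ p.F fun i => ξ.hom (p.f i))
        (fun i => (γ 0).hom (p.f i)) := by
      rw [h0]
      exact (p.contDiff.differentiable (by simp) _).hasFDerivAt
    exact (h2.comp_hasDerivAt (0 : ℝ) h1).congr_of_eventuallyEq (hcont.eventually p.eventuallyEq)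
  exact (key _).unique (key p)

/-- The action on `f^A` is the derivation itself. -/
lemma VFieldA.act_lift (X : VFieldA n M A) (f : Smooth n M) :
    X.act (lift A f) = (X f : NearPoint n M A → A) := by
  funext ξ
  rw [X.act_eq _ ξ ⟨1, fun _ => f, fun a => a 0, by fun_prop, Filter.Eventually.of_forall
    fun _ => rfl⟩]
  have : HasFDerivAt (fun a : Fin 1 → A => a 0) (ContinuousLinearMap.proj (R := ℝ) 0)
      (fun _ => ξ.hom f) :=
    (ContinuousLinearMap.proj (R := ℝ) (φ := fun _ : Fin 1 => A) 0).hasFDerivAt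
  rw [this.fderiv]
  rfl

omit [IsManifold (𝓡 n) ∞ M] [T2Space M] in
/-- A function which agrees with a smooth one near every point is smooth. -/
lemma isSmooth_of_eventuallyEq {φ : NearPoint n M A → A}
    (h : ∀ ξ, ∃ ψ : SmoothA n M A, ∀ᶠ ζ in 𝓝 ξ, φ ζ = (ψ : NearPoint n M A → A) ζ) :
    IsSmooth φ := by
  intro ξ
  obtain ⟨ψ, hψ⟩ := h ξ
  obtain ⟨p⟩ := ψ.2 ξ
  refine ⟨⟨p.k, p.f, p.F, p.contDiff, ?_⟩⟩
  filter_upwards [hψ, p.eventuallyEq] with ζ h1 h2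
  rw [h1, h2]

/-- The action of `θ^A` preserves smooth functions: in terms of a presentation it is a smooth
expression in the `f_i^A` and the `(θ f_i)^A`. -/
lemma isSmooth_act_prolong (θ : VField n M) (φ : SmoothA n M A) :
    IsSmooth ((prolong A θ).act φ) := by
  intro ξ
  obtain ⟨p⟩ := φ.2 ξ
  refine ⟨⟨p.k + p.k, Fin.append p.f (fun i => θ (p.f i)), fun a =>
    fderiv ℝ p.F (fun i => a (Fin.castAdd _ i)) (fun i => a (Fin.natAdd _ i)), ?_, ?_⟩⟩
  · exact ((p.contDiff.fderiv_right (m := ∞) (by simp)).comp (by fun_prop)).clm_apply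
      (by fun_prop)
  · filter_upwards [p.eventuallyEq.eventually_nhds] with ζ hζ
    rw [VFieldA.act_eq _ φ ζ ⟨p.k, p.f, p.F, p.contDiff, hζ⟩]
    simp only [Fin.append_left, Fin.append_right]
    rfl

omit [IsManifold (𝓡 n) ∞ M] [T2Space M] in
/-- Two smooth functions have presentations by the same functions of `M`. -/
lemma exists_common_presentation (φ ψ : SmoothA n M A) (ξ : NearPoint n M A) :
    ∃ (k : ℕ) (f : Fin k → Smooth n M) (F G : (Fin k → A) → A),
      ContDiff ℝ ∞ F ∧ ContDiff ℝ ∞ G ∧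
      (∀ᶠ ζ in 𝓝 ξ, (φ : NearPoint n M A → A) ζ = F (fun i => ζ.hom (f i))) ∧
      ∀ᶠ ζ in 𝓝 ξ, (ψ : NearPoint n M A → A) ζ = G (fun i => ζ.hom (f i)) := by
  obtain ⟨p⟩ := φ.2 ξ
  obtain ⟨q⟩ := ψ.2 ξ
  refine ⟨p.k + q.k, Fin.append p.f q.f, fun a => p.F (fun i => a (Fin.castAdd _ i)),
    fun a => q.F (fun i => a (Fin.natAdd _ i)), p.contDiff.comp (by fun_prop),
    q.contDiff.comp (by fun_prop), ?_, ?_⟩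
  · filter_upwards [p.eventuallyEq] with ζ h
    simp [h]
  · filter_upwards [q.eventuallyEq] with ζ h
    simp [h]

lemma VFieldA.act_add (X : VFieldA n M A) (φ ψ : SmoothA n M A) :
    X.act (φ + ψ) = X.act φ + X.act ψ := by
  funext ξ
  obtain ⟨k, f, F, G, hF, hG, h1, h2⟩ := exists_common_presentation φ ψ ξ
  rw [Pi.add_apply, X.act_eq φ ξ ⟨k, f, F, hF, h1⟩, X.act_eq ψ ξ ⟨k, f, G, hG, h2⟩,
    X.act_eq (φ + ψ) ξ ⟨k, f, F + G, hF.add hG, by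
      filter_upwards [h1, h2] with ζ h1 h2
      exact congrArg₂ (· + ·) h1 h2⟩]
  dsimp only
  rw [fderiv_add (hF.differentiable (by simp) _) (hG.differentiable (by simp) _)]
  rfl

lemma VFieldA.act_smul (X : VFieldA n M A) (a : A) (φ : SmoothA n M A) :
    X.act (a • φ) = a • X.act φ := by
  funext ξ
  obtain ⟨p⟩ := φ.2 ξ
  rw [Pi.smul_apply, X.act_eq φ ξ p,
    X.act_eq (a • φ) ξ ⟨p.k, p.f, fun b => a * p.F b, contDiff_const.mul p.contDiff, by
      filter_upwards [p.eventuallyEq] with ζ h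
      exact congrArg (a * ·) h⟩]
  dsimp only
  rw [fderiv_const_mul (p.contDiff.differentiable (by simp) _)]
  rfl

lemma VFieldA.act_mul (X : VFieldA n M A) (φ ψ : SmoothA n M A) :
    X.act (φ * ψ) = (φ : NearPoint n M A → A) * X.act ψ + (ψ : NearPoint n M A → A) * X.act φ := by
  funext ξ
  obtain ⟨k, f, F, G, hF, hG, h1, h2⟩ := exists_common_presentation φ ψ ξ
  rw [Pi.add_apply, Pi.mul_apply, Pi.mul_apply,
    X.act_eq φ ξ ⟨k, f, F, hF, h1⟩, X.act_eq ψ ξ ⟨k, f, G, hG, h2⟩,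
    X.act_eq (φ * ψ) ξ ⟨k, f, F * G, hF.mul hG, by
      filter_upwards [h1, h2] with ζ h1 h2
      exact congrArg₂ (· * ·) h1 h2⟩]
  dsimp only
  rw [fderiv_mul (hF.differentiable (by simp) _) (hG.differentiable (by simp) _),
    h1.self_of_nhds, h2.self_of_nhds]
  rfl

variable (A) in
/-- The action of `θ^A` on `C^∞(M^A, A)`, as an `A`-linear derivation. -/
def prolongDerivation (θ : VField n M) : Derivation A (SmoothA n M A) (SmoothA n M A) :=
  Derivation.mk'
    { toFun := fun φ => ⟨(prolong A θ).act φ, isSmooth_act_prolong θ φ⟩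
      map_add' := fun φ ψ => Subtype.ext (VFieldA.act_add _ φ ψ)
      map_smul' := fun a φ => Subtype.ext (VFieldA.act_smul _ a φ) }
    (fun φ ψ => Subtype.ext (VFieldA.act_mul _ φ ψ))

end Curve

/-! ### Bilinear and alternating maps -/

section Alternating

variable {R V N : Type*} [CommSemiring R] [AddCommMonoid V] [Module R V] [AddCommMonoid N]
  [Module R N]

/-- An alternating bilinear map as an alternating map in two variables. -/
def alternatingOfBilin (B : V →ₗ[R] V →ₗ[R] N) (hB : ∀ x, B x x = 0) : V [⋀^Fin 2]→ₗ[R] N where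
  toFun v := B (v 0) (v 1)
  map_update_add' v i x y := by fin_cases i <;> simp
  map_update_smul' v i c x := by fin_cases i <;> simp
  map_eq_zero_of_eq' v i j h hij := by
    have h01 : v 0 = v 1 := by
      fin_cases i <;> fin_cases j <;> first | exact absurd rfl hij | exact h | exact h.symm
    rw [h01, hB]

/-- An alternating map in two variables as a bilinear map. -/
def alternatingBilin (g : V [⋀^Fin 2]→ₗ[R] N) : V →ₗ[R] V →ₗ[R] N :=
  have hu : ∀ x y : V, Function.update ![x, 0] 1 y = ![x, y] := fun x y => by
    ext i
    fin_cases i <;> simp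
  LinearMap.mk₂ R (fun x y => g ![x, y]) (fun x x' y => g.map_vecCons_add ![y] x x')
    (fun c x y => g.map_vecCons_smul ![y] c x)
    (fun x y y' => by simpa only [hu] using g.map_update_add ![x, 0] 1 y y')
    (fun c x y => by simpa only [hu] using g.map_update_smul ![x, 0] 1 c y)

lemma alternating_swap {R V N : Type*} [CommRing R] [AddCommGroup V] [Module R V] [AddCommGroup N]
    [Module R N] (g : V [⋀^Fin 2]→ₗ[R] N) (x y : V) : g ![x, y] = -g ![y, x] := by
  have h := g.map_swap ![y, x] (i := 0) (j := 1) (by decide)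
  rw [← h]
  congr 1
  ext i
  fin_cases i <;> rfl

end Alternating

/-! ### Vector fields of the Weil bundle in a frame -/

section Extension

variable {n : ℕ} {M : Type*} [TopologicalSpace M] [ChartedSpace (EuclideanSpace ℝ (Fin n)) M]
variable {A : Type*} [NormedCommRing A] [NormedAlgebra ℝ A] [IsWeilAlgebra A]
variable [IsManifold (𝓡 n) ∞ M] [T2Space M]

/-- The points of `M^A` over an open set are a neighbourhood of each of them: they contain the
points where `ρ^A` is invertible, for a suitable bump function `ρ`. -/
lemma eventually_hasOrigin_imp_mem {U : Set M} (hU : IsOpen U) {ξ : NearPoint n M A} {q : M}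
    (hξ : HasOrigin ξ.hom q) (hq : q ∈ U) :
    ∀ᶠ ζ : NearPoint n M A in 𝓝 ξ, ∀ p, HasOrigin ζ.hom p → p ∈ U := by
  obtain ⟨ρ, h1, h2⟩ := exists_bump (n := n) hU hq
  have : CompleteSpace A := FiniteDimensional.complete ℝ A
  have hcont : Continuous fun ζ : NearPoint n M A => ζ.hom ρ :=
    (continuous_apply ρ).comp continuous_induced_dom
  filter_upwards [hcont.continuousAt.eventually (Units.isOpen.mem_nhds
    (hξ.isUnit (f := ρ) (by simp [h1])))] with ζ hζ p hp
  by_contra hpU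
  have h3 := hp ρ
  rw [image_eq_zero_of_notMem_tsupport fun h => hpU (h2 h), map_zero, sub_zero] at h3
  exact (IsLocalRing.mem_maximalIdeal _).1 h3 hζ

variable {U : Set M} (F : LocalFrame n U)

lemma VFieldA.apply_eq_sum (X : VFieldA n M A) {ξ : NearPoint n M A} {q : M} (hq : q ∈ U)
    (hξ : HasOrigin ξ.hom q) (f : Smooth n M) : (X f : NearPoint n M A → A) ξ =
      ∑ i, (X (F.coord i) : NearPoint n M A → A) ξ * ξ.hom (F.field i f) :=
  F.derivation_eq_sum hq hξ (X.isDerivationAlong_tangent ξ) f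

/-- Cut off by a function with support in the domain of a frame, a vector field of `M^A` is a
combination of prolongations. -/
lemma VFieldA.lift_smul_eq_sum {ρ : Smooth n M} (hρ : tsupport ρ ⊆ U) (X : VFieldA n M A) :
    lift A ρ • X = ∑ i, X (F.coord i) • prolong A (ρ • F.field i) := by
  ext f ξ
  let e : VFieldA n M A →+ A := ⟨⟨fun X => (X f : NearPoint n M A → A) ξ, rfl⟩, fun _ _ => rfl⟩
  change e (lift A ρ • X) = e (∑ i, X (F.coord i) • prolong A (ρ • F.field i))
  rw [map_sum]
  change ξ.hom ρ * (X f : NearPoint n M A → A) ξ =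
    ∑ i, (X (F.coord i) : NearPoint n M A → A) ξ * ξ.hom (ρ * F.field i f)
  obtain ⟨q, hξ⟩ := ξ.exists_hasOrigin
  by_cases hq : q ∈ U
  · rw [X.apply_eq_sum F hq hξ, Finset.mul_sum]
    refine Finset.sum_congr rfl fun i _ => ?_
    rw [map_mul]
    ring
  · have h0 : ξ.hom ρ = 0 := hξ.map_eq_zero
      (notMem_tsupport_iff_eventuallyEq.1 fun h => hq (hρ h))
    simp [h0]

/-- Cut off by a function with support in the domain of a frame, a vector field of `M` is a
combination of the fields of the frame. -/
lemma VField.smul_eq_sum {ρ : Smooth n M} (hρ : tsupport ρ ⊆ U) (θ : VField n M) :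
    ρ • θ = ∑ i, θ (F.coord i) • ρ • F.field i := by
  ext f y
  let e : VField n M →+ ℝ := ⟨⟨fun X => X f y, rfl⟩, fun _ _ => rfl⟩
  change e (ρ • θ) = e (∑ i, θ (F.coord i) • ρ • F.field i)
  rw [map_sum]
  change ρ y * θ f y = ∑ i, θ (F.coord i) y * (ρ y * F.field i f y)
  by_cases hy : y ∈ U
  · have h := F.derivation_eq_sum hy (hasOrigin_evalHom y) (isDerivationAlong_evalHom θ y) f
    change θ f y = ∑ i, θ (F.coord i) y * F.field i f y at h
    rw [h, Finset.mul_sum]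
    exact Finset.sum_congr rfl fun i _ => by ring
  · simp [image_eq_zero_of_notMem_tsupport fun h => hy (hρ h)]

/-- The prolongations generate the vector fields of `M^A`, so an `A`-form is determined by
its values on them. -/
lemma eq_of_eq_on_prolong {β β' : VFieldA n M A →ₗ[SmoothA n M A] SmoothA n M A}
    (h : ∀ θ : VField n M, β (prolong A θ) = β' (prolong A θ)) : β = β' := by
  ext X ξ
  obtain ⟨q, hξ⟩ := ξ.exists_hasOrigin
  obtain ⟨U, hq, ⟨F⟩⟩ := exists_localFrame (n := n) q
  obtain ⟨ρ, h1, h2⟩ := exists_bump (n := n) F.isOpen hq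
  have hu := hξ.isUnit (f := ρ) (by simp [h1])
  have key : lift A ρ • β X = lift A ρ • β' X := by
    rw [← map_smul, ← map_smul, X.lift_smul_eq_sum F h2]
    simp only [map_sum, map_smul, h]
  have := congrArg (fun φ : SmoothA n M A => (φ : NearPoint n M A → A) ξ) key
  exact hu.mul_left_cancel this

lemma bilin_eq_of_eq_on_prolong
    {B B' : VFieldA n M A →ₗ[SmoothA n M A] VFieldA n M A →ₗ[SmoothA n M A] SmoothA n M A}
    (h : ∀ θ θ' : VField n M, B (prolong A θ) (prolong A θ') = B' (prolong A θ) (prolong A θ')) :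
    B = B' := by
  have h1 : ∀ θ : VField n M, B (prolong A θ) = B' (prolong A θ) := fun θ =>
    eq_of_eq_on_prolong fun θ' => h θ θ'
  refine LinearMap.ext fun X => ?_
  refine eq_of_eq_on_prolong fun θ' => ?_
  have h2 : B.flip (prolong A θ') = B'.flip (prolong A θ') :=
    eq_of_eq_on_prolong fun θ => by rw [LinearMap.flip_apply, LinearMap.flip_apply, h1]
  exact LinearMap.congr_fun h2 X

/-! ### Extension of forms from prolongations to all vector fields -/

variable (α : VField n M →ₗ[Smooth n M] SmoothA n M A)

/-- The value of `α` on `θ`, in a frame. -/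
lemma linear_apply_eq_sum (θ : VField n M) {ξ : NearPoint n M A} {q : M} (hq : q ∈ U)
    (hξ : HasOrigin ξ.hom q) : (α θ : NearPoint n M A → A) ξ =
      ∑ i, ξ.hom (θ (F.coord i)) * (α (F.field i) : NearPoint n M A → A) ξ := by
  obtain ⟨ρ, h1, h2⟩ := exists_bump (n := n) F.isOpen hq
  have hu := hξ.isUnit (f := ρ) (by simp [h1])
  have key : ρ • α θ = ∑ i, θ (F.coord i) • ρ • α (F.field i) := by
    rw [← map_smul, VField.smul_eq_sum F h2, map_sum]
    simp only [map_smul]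
  let e : SmoothA n M A →+ A := ⟨⟨fun φ => (φ : NearPoint n M A → A) ξ, rfl⟩, fun _ _ => rfl⟩
  have := congrArg e key
  rw [map_sum] at this
  change ξ.hom ρ * _ = ∑ i, ξ.hom (θ (F.coord i)) * (ξ.hom ρ * _) at this
  refine hu.mul_left_cancel (this.trans ?_)
  rw [Finset.mul_sum]
  exact Finset.sum_congr rfl fun i _ => mul_left_comm _ _ _

/-- The function `∑ X(x_i) α(∂_i)` on `M^A`, for the frame `(x_i, ∂_i)`. -/
def frameValue (X : VFieldA n M A) : SmoothA n M A := ∑ i, X (F.coord i) * α (F.field i)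

omit [IsManifold (𝓡 n) ∞ M] [T2Space M] in
lemma frameValue_apply (X : VFieldA n M A) (ξ : NearPoint n M A) :
    (frameValue F α X : NearPoint n M A → A) ξ = ∑ i,
      (X (F.coord i) : NearPoint n M A → A) ξ * (α (F.field i) : NearPoint n M A → A) ξ := by
  let e : SmoothA n M A →+ A := ⟨⟨fun φ => (φ : NearPoint n M A → A) ξ, rfl⟩, fun _ _ => rfl⟩
  exact map_sum e _ _

/-- The value `∑ X(x_i) α(∂_i)` does not depend on the frame. -/
lemma frameValue_eq {U' : Set M} (F' : LocalFrame n U') (X : VFieldA n M A) {ξ : NearPoint n M A}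
    {q : M} (hq : q ∈ U) (hq' : q ∈ U') (hξ : HasOrigin ξ.hom q) :
    (frameValue F α X : NearPoint n M A → A) ξ = (frameValue F' α X : NearPoint n M A → A) ξ := by
  rw [frameValue_apply, frameValue_apply]
  simp only [X.apply_eq_sum F hq hξ (F'.coord _), linear_apply_eq_sum F' α (F.field _) hq' hξ,
    Finset.mul_sum, Finset.sum_mul]
  rw [Finset.sum_comm]
  simp only [mul_assoc]

/-- The origin of a near point. -/
def NearPoint.origin (ξ : NearPoint n M A) : M := ξ.exists_hasOrigin.choose

omit [IsManifold (𝓡 n) ∞ M] [T2Space M] in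
lemma NearPoint.hasOrigin (ξ : NearPoint n M A) : HasOrigin ξ.hom ξ.origin :=
  ξ.exists_hasOrigin.choose_spec

/-- The domain of a chosen frame near `p`. -/
def frameDomain (n : ℕ) {M : Type*} [TopologicalSpace M]
    [ChartedSpace (EuclideanSpace ℝ (Fin n)) M] [IsManifold (𝓡 n) ∞ M] [T2Space M] (p : M) :
    Set M := (exists_localFrame (n := n) p).choose

lemma mem_frameDomain (p : M) : p ∈ frameDomain n p :=
  (exists_localFrame (n := n) p).choose_spec.1

/-- A chosen frame near `p`. -/
def frameAt (n : ℕ) {M : Type*} [TopologicalSpace M]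
    [ChartedSpace (EuclideanSpace ℝ (Fin n)) M] [IsManifold (𝓡 n) ∞ M] [T2Space M] (p : M) :
    LocalFrame n (frameDomain n p) :=
  (exists_localFrame (n := n) p).choose_spec.2.some

/-- The extension `α^A` of `α` to the vector fields of `M^A`: the `C^∞(M^A, A)`-linear form which
is `∑ X(x_i) α(∂_i)` in every frame. -/
def extendForm : VFieldA n M A →ₗ[SmoothA n M A] SmoothA n M A where
  toFun X := ⟨fun ξ => (frameValue (frameAt n ξ.origin) α X : NearPoint n M A → A) ξ,
    isSmooth_of_eventuallyEq fun ξ => ⟨frameValue (frameAt n ξ.origin) α X, by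
      filter_upwards [eventually_hasOrigin_imp_mem (frameAt n ξ.origin).isOpen ξ.hasOrigin
        (mem_frameDomain _)] with ζ hζ
      exact frameValue_eq _ α _ X (mem_frameDomain _) (hζ _ ζ.hasOrigin) ζ.hasOrigin⟩⟩
  map_add' X Y := by
    ext ξ
    change (frameValue _ α (X + Y) : NearPoint n M A → A) ξ =
      (frameValue _ α X : NearPoint n M A → A) ξ + (frameValue _ α Y : NearPoint n M A → A) ξ
    simp only [frameValue_apply, ← Finset.sum_add_distrib, ← add_mul]
    rfl
  map_smul' φ X := by
    ext ξ
    change (frameValue _ α (φ • X) : NearPoint n M A → A) ξ =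
      (φ : NearPoint n M A → A) ξ * (frameValue _ α X : NearPoint n M A → A) ξ
    simp only [frameValue_apply, Finset.mul_sum, ← mul_assoc]
    rfl

lemma extendForm_apply (X : VFieldA n M A) (ξ : NearPoint n M A) :
    (extendForm α X : NearPoint n M A → A) ξ = ∑ i,
      (X ((frameAt n ξ.origin).coord i) : NearPoint n M A → A) ξ *
        (α ((frameAt n ξ.origin).field i) : NearPoint n M A → A) ξ :=
  frameValue_apply _ α X ξ

lemma extendForm_prolong (θ : VField n M) : extendForm α (prolong A θ) = α θ := by
  ext ξ
  rw [extendForm_apply,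
    linear_apply_eq_sum (frameAt n ξ.origin) α θ (mem_frameDomain _) ξ.hasOrigin]
  rfl

/-- `f ↦ f^A` as a `C^∞(M)`-linear map. -/
def liftLinear : Smooth n M →ₗ[Smooth n M] SmoothA n M A where
  toFun := lift A
  map_add' := map_add _
  map_smul' f g := map_mul (lift A) f g

variable (Ω : Form n M 2)

variable (A) in
/-- The form `θ' ↦ Ω(θ, θ')^A`. -/
def interiorLift (θ : VField n M) : VField n M →ₗ[Smooth n M] SmoothA n M A :=
  liftLinear ∘ₗ alternatingBilin Ω θ

/-- The form `θ ↦ (i_θ Ω)^A(Y)`, for a vector field `Y` of `M^A`. -/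
def interiorExtend (Y : VFieldA n M A) : VField n M →ₗ[Smooth n M] SmoothA n M A where
  toFun θ := extendForm (interiorLift A Ω θ) Y
  map_add' θ θ' := by
    ext ξ
    change _ = (extendForm _ Y : NearPoint n M A → A) ξ + (extendForm _ Y : NearPoint n M A → A) ξ
    simp only [extendForm_apply, ← Finset.sum_add_distrib, ← mul_add]
    refine Finset.sum_congr rfl fun i _ => ?_
    simp only [interiorLift, map_add, LinearMap.comp_apply, LinearMap.add_apply]
    rfl
  map_smul' f θ := by
    ext ξ
    change _ = ξ.hom f * (extendForm _ Y : NearPoint n M A → A) ξ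
    simp only [extendForm_apply, Finset.mul_sum]
    refine Finset.sum_congr rfl fun i _ => ?_
    simp only [interiorLift, map_smul, LinearMap.comp_apply, LinearMap.smul_apply]
    exact mul_left_comm _ _ _

variable (A) in
/-- The extension of `Ω` to a bilinear form on the vector fields of `M^A`, one variable at a
time. -/
def extendBilin :
    VFieldA n M A →ₗ[SmoothA n M A] VFieldA n M A →ₗ[SmoothA n M A] SmoothA n M A :=
  LinearMap.mk₂ _ (fun X Y => extendForm (interiorExtend Ω Y) X)
    (fun X X' Y => map_add _ X X') (fun φ X Y => map_smul _ φ X)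
    (fun X Y Y' => by
      ext ξ
      change _ = (extendForm _ X : NearPoint n M A → A) ξ + (extendForm _ X : NearPoint n M A → A) ξ
      simp only [extendForm_apply _ X, ← Finset.sum_add_distrib, ← mul_add]
      refine Finset.sum_congr rfl fun i _ => ?_
      rw [interiorExtend, LinearMap.coe_mk, AddHom.coe_mk, map_add]
      rfl)
    (fun φ X Y => by
      ext ξ
      change _ = (φ : NearPoint n M A → A) ξ * (extendForm _ X : NearPoint n M A → A) ξ
      simp only [extendForm_apply _ X, Finset.mul_sum]
      refine Finset.sum_congr rfl fun i _ => ?_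
      rw [interiorExtend, LinearMap.coe_mk, AddHom.coe_mk, map_smul]
      exact mul_left_comm _ _ _)

lemma extendBilin_prolong (θ θ' : VField n M) :
    extendBilin A Ω (prolong A θ) (prolong A θ') = lift A (Ω ![θ, θ']) := by
  change extendForm (interiorExtend Ω _) _ = _
  rw [extendForm_prolong]
  change extendForm (interiorLift A Ω θ) _ = _
  rw [extendForm_prolong]
  rfl

lemma extendBilin_self (X : VFieldA n M A) : extendBilin A Ω X X = 0 := by
  -- the form is skew-symmetric, as it is so on the prolongations
  have hskew : extendBilin A Ω + (extendBilin A Ω).flip = 0 :=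
    bilin_eq_of_eq_on_prolong fun θ θ' => by
      rw [LinearMap.add_apply, LinearMap.add_apply, LinearMap.flip_apply, extendBilin_prolong,
        extendBilin_prolong, alternating_swap, map_neg, neg_add_cancel]
      rfl
  have h : extendBilin A Ω X X + extendBilin A Ω X X = 0 :=
    LinearMap.congr_fun (LinearMap.congr_fun hskew X) X
  ext ξ
  have hξ : (extendBilin A Ω X X : NearPoint n M A → A) ξ +
      (extendBilin A Ω X X : NearPoint n M A → A) ξ = 0 :=
    congrArg (fun φ : SmoothA n M A => (φ : NearPoint n M A → A) ξ) h
  rw [← two_smul ℝ] at hξ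
  exact (smul_eq_zero.1 hξ).resolve_left two_ne_zero

/-- An `A`-form of degree two as a bilinear form. -/
def FormA.bilin (η : FormA n M A 2) :
    VFieldA n M A →ₗ[SmoothA n M A] VFieldA n M A →ₗ[SmoothA n M A] SmoothA n M A :=
  alternatingBilin η

omit [IsManifold (𝓡 n) ∞ M] [T2Space M] in
lemma FormA.bilin_apply (η : FormA n M A 2) (X Y : VFieldA n M A) :
    FormA.bilin η X Y = η ![X, Y] := rfl

omit [IsManifold (𝓡 n) ∞ M] [T2Space M] in
lemma isProlongationForm_iff {Ω : Form n M 2} {ΩA : FormA n M A 2} :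
    IsProlongationForm Ω ΩA ↔ ∀ θ θ' : VField n M,
      FormA.bilin ΩA (prolong A θ) (prolong A θ') = lift A (Ω ![θ, θ']) := by
  have hvec : ∀ θ : Fin 2 → VField n M,
      (fun i => prolong A (θ i)) = ![prolong A (θ 0), prolong A (θ 1)] := fun θ => by
    ext1 i
    fin_cases i <;> rfl
  have hvec' : ∀ θ : Fin 2 → VField n M, θ = ![θ 0, θ 1] := fun θ => by
    ext1 i
    fin_cases i <;> rfl
  refine ⟨fun h θ θ' => ?_, fun h θ => ?_⟩
  · rw [← h ![θ, θ'], hvec]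
    rfl
  · rw [hvec, hvec' θ]
    exact h _ _

lemma existsUnique_isProlongationForm : ∃! ΩA : FormA n M A 2, IsProlongationForm Ω ΩA := by
  have hex : IsProlongationForm Ω (alternatingOfBilin (extendBilin A Ω) (extendBilin_self Ω)) := by
    refine isProlongationForm_iff.2 fun θ θ' => ?_
    rw [FormA.bilin_apply]
    exact extendBilin_prolong Ω θ θ'
  refine ⟨_, hex, fun η hη => ?_⟩
  have hη := isProlongationForm_iff.1 hη
  have h : FormA.bilin η = extendBilin A Ω :=
    bilin_eq_of_eq_on_prolong fun θ θ' => (hη θ θ').trans (extendBilin_prolong Ω θ θ').symm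
  ext1 v
  change η v = extendBilin A Ω (v 0) (v 1)
  rw [← h, FormA.bilin_apply]
  congr 1
  ext1 i
  fin_cases i <;> rfl

variable (A) in
/-- The differential `d^A(f^A)` as an `A`-form of degree one. -/
def differentialLift (f : Smooth n M) : VFieldA n M A →ₗ[SmoothA n M A] SmoothA n M A where
  toFun Y := Y f
  map_add' _ _ := rfl
  map_smul' _ _ := rfl

/-- The equation `i_θ Ω = -df` prolongs, since it suffices to compare the two sides on
prolongations. -/
lemma interiorA_prolong {Ω : Form n M 2} {ΩA : FormA n M A 2} (hΩA : IsProlongationForm Ω ΩA)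
    {θ : VField n M} {f : Smooth n M} (h : interior Ω θ = -differential f) :
    interiorA ΩA (prolong A θ) = -differentialA (lift A f) := by
  have key : FormA.bilin ΩA (prolong A θ) = -differentialLift A f :=
    eq_of_eq_on_prolong fun θ' => by
      rw [isProlongationForm_iff.1 hΩA]
      have h' : Ω ![θ, θ'] = -θ' f := congrFun h θ'
      rw [h', map_neg]
      rfl
  funext Y
  change ((FormA.bilin ΩA (prolong A θ) Y : SmoothA n M A) : NearPoint n M A → A) =
    -VFieldA.act Y (lift A f)
  rw [key, VFieldA.act_lift]
  rfl

end Extension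

end WeilBundle

end

theorem mainTheorem6 {n : ℕ} {M : Type*} [TopologicalSpace M]
    [ChartedSpace (EuclideanSpace ℝ (Fin n)) M] [IsManifold (𝓡 n) ∞ M]
    [T2Space M] [ParacompactSpace M]
    {A : Type*} [NormedCommRing A] [NormedAlgebra ℝ A] [WeilBundle.IsWeilAlgebra A]
    (Ω : WeilBundle.Form n M 2) (hΩ : WeilBundle.IsSymplectic Ω) :
    (∃! ΩA : WeilBundle.FormA n M A 2, WeilBundle.IsProlongationForm Ω ΩA) ∧
    ∀ ΩA : WeilBundle.FormA n M A 2, WeilBundle.IsProlongationForm Ω ΩA →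
      ∀ θ : WeilBundle.VField n M,
        (∃ D : Derivation A (WeilBundle.SmoothA n M A) (WeilBundle.SmoothA n M A),
          (∀ φ : WeilBundle.SmoothA n M A,
            (D φ : WeilBundle.NearPoint n M A → A) =
              WeilBundle.VFieldA.act (WeilBundle.prolong A θ) φ) ∧
          ∀ g : WeilBundle.Smooth n M,
            D (WeilBundle.lift A g) = WeilBundle.lift A (θ g)) ∧
        (∀ f : WeilBundle.Smooth n M,
          WeilBundle.interior Ω θ = -WeilBundle.differential f →
          WeilBundle.interiorA ΩA (WeilBundle.prolong A θ) =
            -WeilBundle.differentialA (WeilBundle.lift A f)) ∧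
        (WeilBundle.IsGloballyHamiltonian Ω θ →
          WeilBundle.IsGloballyHamiltonianA ΩA (WeilBundle.prolong A θ)) := by
  refine ⟨WeilBundle.existsUnique_isProlongationForm Ω, fun ΩA hΩA θ =>
    ⟨⟨WeilBundle.prolongDerivation A θ, fun φ => rfl, fun g => ?_⟩,
      fun f h => WeilBundle.interiorA_prolong hΩA h, fun ⟨f, h⟩ =>
      ⟨WeilBundle.lift A f, WeilBundle.interiorA_prolong hΩA h⟩⟩⟩
  exact Subtype.ext (WeilBundle.VFieldA.act_lift _ g)
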